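/- Let $\theta_j\ge 0$, $\kappa_j\ge 0$ ($j\ge 1$) be real sequences. For $\sigma\in\mathfrak S_N$ let $C_j=C_j(\sigma)$ be the number of cycles of length $j$, and let $$P_N(\sigma)=\frac{1}{N!\,H_N}\prod_{j=1}^N(\theta_j+N\kappa_j)^{C_j},\qquad H_N=\frac1{N!}\sum_{\sigma\in\mathfrak S_N}\prod_{j=1}^N(\theta_j+N\kappa_j)^{C_j},$$ with expectation $E_N$. Put $g_\theta(z)=\sum_{j\ge1}\frac{\theta_j}{j}z^j$, $g_\kappa(z)=\sum_{j\ge1}\frac{\kappa_j}{j}z^j$, and let $R\in(0,\infty]$ be the radius of convergence of $g_\kappa$, assumed positive. For $n\ge0$ let $g_\kappa^{\{n\}}(r)=r^n\frac{d^n g_\kappa}{dr^n}(r)=\sum_{j\ge1} j(j-1)\cdots(j-n+1)\frac{\kappa_j}{j}r^j$, and $g_\kappa^{\{n\}}(R)=\lim_{r\uparrow R}g_\kappa^{\{n\}}(r)\in[0,\infty]$ (so $g^{\{1\}}_\kappa(r)=\sum_{j\ge1}\kappa_jr^j$); similarly $g_\theta(R)=\lim_{r\uparrow R} g_\theta(r)$.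 Assume that $\kappa_j>0$ for some $j\ge2$ and that there is no integer $d>1$ dividing every $j$ with $\kappa_j\ne0$. For finite $R$, $\eta>0$ and $0<\varphi<\pi/2$ let $\Delta_0=\{z\in\mathbb C:\ |z|<R\,|1+\eta e^{i\varphi}|,\ z\ne R,\ |\arg(z-R)|>\varphi\}$. Assume that $g_\theta$ is holomorphic in $|z|<R$ and that one of the following six conditions holds, where in (2), (3), (5), (6) the functions $g_\theta,g_\kappa$ are assumed to extend holomorphically to some such $\Delta_0$, the expansions are for $z\to R$, $z\in\Delta_0$, with principal branches, and "log" stands for the condition $g_\theta(z)=-\theta^*\log(1-z/R)+O(|1-z/R|^{\delta})$ with some $\theta^*\ge0$; $\delta>0$ is some constant: 1. $1<g_\kappa^{\{1\}}(R)\le\infty$ (subcritical case); 2. $g_\kappa^{\{1\}}(R)<1$ (supercritical case), log, and $g_\kappa(z)=g_\kappa(R)-g_\kappa^{\{1\}}(R)(1-z/R)+O(|1-z/R|^{1+\delta})$; 3. $g_\kappa^{\{1\}}(R)<1$, $g_\theta$ is regular at $z=R$, and for some non-integer $s>1$ and $a_s\ne0$: $g_\kappa^{\{n\}}(R)<\infty$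 for $n<s$, $g_\kappa^{\{n\}}(R)=\infty$ for $n>s$, and $g_\kappa(z)=\sum_{0\le n<s}\frac{(-1)^ng_\kappa^{\{n\}}(R)}{n!}(1-z/R)^n+a_s(1-z/R)^s+O(|1-z/R|^{s+\delta})$; 4. $g_\kappa^{\{1\}}(R)=1$, $g_\theta(R)<\infty$, $g_\kappa(R)<\infty$ and $0<g_\kappa^{\{2\}}(R)<\infty$; 5. $g_\kappa^{\{1\}}(R)=1$, $0<g_\kappa^{\{2\}}(R)<\infty$, log, and $g_\kappa(z)=g_\kappa(R)-(1-z/R)+\frac{g_\kappa^{\{2\}}(R)}2(1-z/R)^2+O(|1-z/R|^{2+\delta})$; 6. $g_\kappa^{\{1\}}(R)=1$, log, and $g_\kappa(z)=g_\kappa(R)-(1-z/R)+a_s(1-z/R)^s+O(|1-z/R|^{s+\delta})$ for some $s\in(1,2)$, $a_s>0$. Let $r_*$ be the unique solution of $g_\kappa^{\{1\}}(r)=1$, $0<r\le R$, if $g_\kappa^{\{1\}}(R)\ge1$, and $r_*=R$ if $g_\kappa^{\{1\}}(R)\le1$. Define $$\tilde\nu_K=\liminf_{N\to\infty}\frac1N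 E_N\Bigl[\sum_{j>K}jC_j\Bigr],\qquad \tilde\nu=\lim_{K\to\infty}\tilde\nu_K.$$ Then $H_N>0$ for all sufficiently large $N$, $r_*$ is well defined (and finite), and for each integer $K\ge0$ the quantity $\tilde\nu_K$ exists as a limit, with $$\tilde\nu_K=\lim_{N\to\infty}\frac1N E_N\Bigl[\sum_{j>K}jC_j\Bigr]=1-\sum_{j=1}^K\kappa_jr_*^j .$$ Moreover the limit $\tilde\nu$ exists, $\tilde\nu=0$ if $g_\kappa^{\{1\}}(R)\ge1$, and $\tilde\nu=1-g_\kappa^{\{1\}}(R)>0$ if $g_\kappa^{\{1\}}(R)<1$. In particular $\tilde\nu>0$ if and only if $g_\kappa^{\{1\}}(R)<1$. -/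

import Mathlib

open Filter Topology Asymptotics
open scoped ENNReal

noncomputable section

namespace SurrogateSpatial

/-! Sequences `θ, κ : ℕ → ℝ` are indexed by `j ≥ 1`; the entry at `j = 0` is never used. -/

/-! ### The surrogate-spatial measure on permutations -/

/-- The cycle count `C_j(σ)`: the number of cycles of length `j` of `σ`, fixed points being
cycles of length `1` (the parts of `σ.partition` are the cycle lengths, fixed points included). -/
def cycleCount {N : ℕ} (σ : Equiv.Perm (Fin N)) (j : ℕ) : ℕ :=
  σ.partition.parts.count j

/-- The unnormalised weight `∏_{j=1}^N (θ_j + N κ_j)^{C_j(σ)}`. -/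
def weight (θ κ : ℕ → ℝ) (N : ℕ) (σ : Equiv.Perm (Fin N)) : ℝ :=
  ∏ j ∈ Finset.Icc 1 N, (θ j + N * κ j) ^ cycleCount σ j

/-- The normalisation `H_N = (1 / N!) ∑_σ ∏_{j=1}^N (θ_j + N κ_j)^{C_j(σ)}`. -/
def normConst (θ κ : ℕ → ℝ) (N : ℕ) : ℝ :=
  (1 / (N.factorial : ℝ)) * ∑ σ : Equiv.Perm (Fin N), weight θ κ N σ

/-- The probability of the permutation `σ` under the surrogate-spatial measure. -/
def prob (θ κ : ℕ → ℝ) (N : ℕ) (σ : Equiv.Perm (Fin N)) : ℝ :=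
  1 / ((N.factorial : ℝ) * normConst θ κ N) * weight θ κ N σ

/-- The expectation of `X` under the surrogate-spatial measure. -/
def expect (θ κ : ℕ → ℝ) (N : ℕ) (X : Equiv.Perm (Fin N) → ℝ) : ℝ :=
  ∑ σ : Equiv.Perm (Fin N), prob θ κ N σ * X σ

/-- The expected fraction `(1 / N) E_N [∑_{j > K} j C_j]` of points in cycles longer than `K`
(there are no cycles longer than `N`). -/
def longFraction (θ κ : ℕ → ℝ) (K N : ℕ) : ℝ :=
  (1 / (N : ℝ)) * expect θ κ N
    (fun σ => ∑ j ∈ Finset.Ioc K N, (j : ℝ) * (cycleCount σ j : ℝ))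

/-- `ν̃_K = liminf_{N → ∞} (1 / N) E_N [∑_{j > K} j C_j]`. -/
def nuK (θ κ : ℕ → ℝ) (K : ℕ) : ℝ :=
  liminf (fun N : ℕ => longFraction θ κ K N) atTop

/-- `ν̃ = lim_{K → ∞} ν̃_K`. -/
def nu (θ κ : ℕ → ℝ) : ℝ :=
  limUnder atTop (fun K : ℕ => nuK θ κ K)

/-! ### Generating functions -/

/-- The radius of convergence, in `[0, ∞]`, of `g_a(z) = ∑_{j ≥ 1} (a_j / j) z^j`
(the coefficient at `j = 0` is `a 0 / 0 = 0`). -/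
def convRadius (a : ℕ → ℝ) : ℝ≥0∞ :=
  (FormalMultilinearSeries.ofScalars ℂ (fun j : ℕ => ((a j / (j : ℝ) : ℝ) : ℂ))).radius

/-- The modified derivative `g_a^{n}(r) = r^n g_a^{(n)}(r) = ∑_{j ≥ 1} (j)_n (a_j / j) r^j` for
nonnegative coefficients and `0 ≤ r ≤ R`, with values in `[0, ∞]`. By monotone convergence its
value at the radius of convergence `R ∈ (0, ∞]` is the (possibly infinite) limit
as `r ↑ R`. -/
def gMod (a : ℕ → ℝ) (n : ℕ) (r : ℝ≥0∞) : ℝ≥0∞ :=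
  ∑' j : ℕ, ENNReal.ofReal ((j.descFactorial n : ℝ) * (a j / (j : ℝ))) * r ^ j

/-- `g_a^{n}(R)`, where `R` is the radius of convergence of `g_a`. -/
def gModR (a : ℕ → ℝ) (n : ℕ) : ℝ≥0∞ :=
  gMod a n (convRadius a)

/-- Non-arithmeticity and non-degeneracy of the sequence `κ`. -/
structure NonArithmetic (κ : ℕ → ℝ) : Prop where
  aperiodic : ¬ ∃ d : ℕ, 1 < d ∧ ∀ j : ℕ, 1 ≤ j → κ j ≠ 0 → d ∣ j
  nondegenerate : ∃ j : ℕ, 2 ≤ j ∧ 0 < κ j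

/-- `r` is the number `r_*`: the solution of `g_κ^{1}(r) = 1` in `(0, R]` if
`g_κ^{1}(R) ≥ 1`, and `R` if `g_κ^{1}(R) ≤ 1`. -/
structure IsRStar (κ : ℕ → ℝ) (r : ℝ) : Prop where
  pos : 0 < r
  le_radius : ENNReal.ofReal r ≤ convRadius κ
  of_one_le : 1 ≤ gModR κ 1 → gMod κ 1 (ENNReal.ofReal r) = 1
  of_le_one : gModR κ 1 ≤ 1 → ENNReal.ofReal r = convRadius κ

/-! ### Analytic hypotheses -/

/-- The domain `Δ₀(R, η, φ)`: the open disk of radius `R |1 + η e^{iφ}|` with the closed sector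
of half-opening `φ` at the vertex `R` removed. -/
def Delta0 (R η φ : ℝ) : Set ℂ :=
  {z : ℂ | ‖z‖ < ‖(R : ℂ) * (1 + (η : ℂ) * Complex.exp (Complex.I * (φ : ℂ)))‖ ∧
    z ≠ (R : ℂ) ∧ φ < |Complex.arg (z - (R : ℂ))|}

/-- `G` is holomorphic in `D` and extends the sum of the power series `∑_{j ≥ 1} (a_j / j) z^j`,
which converges for `|z| < R`. -/
structure IsContinuation (a : ℕ → ℝ) (R : ℝ) (D : Set ℂ) (G : ℂ → ℂ) : Prop where
  holo : DifferentiableOn ℂ G D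
  hasSum : ∀ z : ℂ, ‖z‖ < R → HasSum (fun j : ℕ => ((a j / (j : ℝ) : ℝ) : ℂ) * z ^ j) (G z)

/-- The logarithmic asymptotics
`G(z) = -θ* log (1 - z/R) + O((1 - z/R)^δ)` as `z → R`, `z ∈ D`. -/
def LogExpansion (R : ℝ) (D : Set ℂ) (G : ℂ → ℂ) (θs δ : ℝ) : Prop :=
  (fun z : ℂ => G z - (-(θs : ℂ) * Complex.log (1 - z / (R : ℂ))))
    =O[𝓝[D] (R : ℂ)] (fun z : ℂ => ‖1 - z / (R : ℂ)‖ ^ δ)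

/-- The Taylor polynomial
`∑_{0 ≤ n < m} ((-1)^n g_κ^{n}(R) / n!) (1 - z/R)^n` of `g_κ` at `R`. -/
def taylorR (κ : ℕ → ℝ) (R : ℝ) (m : ℕ) (z : ℂ) : ℂ :=
  ∑ n ∈ Finset.range m,
    ((-1 : ℂ) ^ n * ((gModR κ n).toReal : ℂ) / (n.factorial : ℂ)) * (1 - z / (R : ℂ)) ^ n

/-- `G(z) = ∑_{0 ≤ n < m} ((-1)^n g_κ^{n}(R) / n!) (1 - z/R)^n + c (1 - z/R)^s + O((1 - z/R)^e)`
as `z → R`, `z ∈ D`. -/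
def PowerExpansion (κ : ℕ → ℝ) (R : ℝ) (D : Set ℂ) (G : ℂ → ℂ) (m : ℕ) (c s e : ℝ) : Prop :=
  (fun z : ℂ => G z - (taylorR κ R m z + (c : ℂ) * (1 - z / (R : ℂ)) ^ (s : ℂ)))
    =O[𝓝[D] (R : ℂ)] (fun z : ℂ => ‖1 - z / (R : ℂ)‖ ^ e)

/-- Subcritical case: `g_θ` and `g_κ` are holomorphic in `|z| < R` with `R` the radius of
convergence of `g_κ` (possibly `R = ∞`), and `1 < g_κ^{1}(R) ≤ ∞`. -/
def SubcriticalHyp (θ κ : ℕ → ℝ) : Prop :=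
  convRadius κ ≤ convRadius θ ∧ 1 < gModR κ 1

/-- Supercritical case, with a logarithmic singularity of `g_θ`. -/
def SupercriticalLogHyp (θ κ : ℕ → ℝ) (R : ℝ) : Prop :=
  gModR κ 1 < 1 ∧
  ∃ (η φ θs δ : ℝ) (Gθ Gκ : ℂ → ℂ),
    0 < η ∧ 0 < φ ∧ φ < Real.pi / 2 ∧ 0 ≤ θs ∧ 0 < δ ∧
    IsContinuation θ R (Delta0 R η φ) Gθ ∧
    IsContinuation κ R (Delta0 R η φ) Gκ ∧
    LogExpansion R (Delta0 R η φ) Gθ θs δ ∧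
    PowerExpansion κ R (Delta0 R η φ) Gκ 2 0 0 (1 + δ)

/-- Supercritical case, with `g_θ` regular at `R` and a power singularity of `g_κ` of
non-integer order `s > 1`. -/
def SupercriticalPowerHyp (θ κ : ℕ → ℝ) (R : ℝ) : Prop :=
  gModR κ 1 < 1 ∧
  ∃ (η φ s as δ : ℝ) (Gθ Gκ : ℂ → ℂ),
    0 < η ∧ 0 < φ ∧ φ < Real.pi / 2 ∧
    1 < s ∧ (∀ n : ℕ, s ≠ (n : ℝ)) ∧ as ≠ 0 ∧ 0 < δ ∧
    (∀ n : ℕ, (n : ℝ) < s → gModR κ n < ∞) ∧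
    (∀ n : ℕ, s < (n : ℝ) → gModR κ n = ∞) ∧
    IsContinuation θ R (Delta0 R η φ) Gθ ∧ AnalyticAt ℂ Gθ (R : ℂ) ∧
    IsContinuation κ R (Delta0 R η φ) Gκ ∧
    PowerExpansion κ R (Delta0 R η φ) Gκ ⌈s⌉₊ as s (s + δ)

/-- Critical case, with `g_θ(R) < ∞` and finite second derivative of `g_κ` at `R`. -/
def CriticalFiniteHyp (θ κ : ℕ → ℝ) : Prop :=
  convRadius κ ≤ convRadius θ ∧ gMod θ 0 (convRadius κ) < ∞ ∧ gModR κ 0 < ∞ ∧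
  gModR κ 1 = 1 ∧ 0 < gModR κ 2 ∧ gModR κ 2 < ∞

/-- Critical case, with a logarithmic singularity of `g_θ` and finite second derivative of `g_κ`
at `R`. -/
def CriticalLogHyp (θ κ : ℕ → ℝ) (R : ℝ) : Prop :=
  gModR κ 1 = 1 ∧ 0 < gModR κ 2 ∧ gModR κ 2 < ∞ ∧
  ∃ (η φ θs δ : ℝ) (Gθ Gκ : ℂ → ℂ),
    0 < η ∧ 0 < φ ∧ φ < Real.pi / 2 ∧ 0 ≤ θs ∧ 0 < δ ∧
    IsContinuation θ R (Delta0 R η φ) Gθ ∧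
    IsContinuation κ R (Delta0 R η φ) Gκ ∧
    LogExpansion R (Delta0 R η φ) Gθ θs δ ∧
    PowerExpansion κ R (Delta0 R η φ) Gκ 3 0 0 (2 + δ)

/-- Critical case, with a logarithmic singularity of `g_θ` and a power singularity of `g_κ` of
order `s ∈ (1, 2)`. -/
def CriticalPowerHyp (θ κ : ℕ → ℝ) (R : ℝ) : Prop :=
  gModR κ 1 = 1 ∧
  ∃ (η φ θs s as δ : ℝ) (Gθ Gκ : ℂ → ℂ),
    0 < η ∧ 0 < φ ∧ φ < Real.pi / 2 ∧ 0 ≤ θs ∧ 1 < s ∧ s < 2 ∧ 0 < as ∧ 0 < δ ∧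
    IsContinuation θ R (Delta0 R η φ) Gθ ∧
    IsContinuation κ R (Delta0 R η φ) Gκ ∧
    LogExpansion R (Delta0 R η φ) Gθ θs δ ∧
    PowerExpansion κ R (Delta0 R η φ) Gκ 2 as s (s + δ)

/-- The standing analytic assumption: one of the hypotheses above holds, where `R` is the radius
of convergence of `g_κ`. It is finite in all cases except possibly the subcritical one, so that
`R.toReal` is `R` wherever it occurs. -/
def AnalyticHyp (θ κ : ℕ → ℝ) : Prop :=
  SubcriticalHyp θ κ ∨
  SupercriticalLogHyp θ κ (convRadius κ).toReal ∨
  SupercriticalPowerHyp θ κ (convRadius κ).toReal ∨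
  CriticalFiniteHyp θ κ ∨
  CriticalLogHyp θ κ (convRadius κ).toReal ∨
  CriticalPowerHyp θ κ (convRadius κ).toReal

end SurrogateSpatial

end

namespace SurrogateSpatial

/-! Grouping permutations by cycle type turns `normConst` into a sum over the partitions of N of ∏
(x_j/j)^{c_j}/c_j! with x_j = θ_j + Nκ_j, that is, into the coefficient of z^N in exp(g_θ(z) + N
g_κ(z)). Only its exponential rate g_κ(r_*) - log r_* matters.

Upper bound (`partitionSum_mul_pow_le`): the coefficients are nonnegative, so each is at most
exp(g_θ(s) + N g_κ(s))/s^N for every s < r_*. Lower bound (`exists_le_partitionSum`): a single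
partition, with multiplicities close to Nκ_j u^j/j, carries the whole sum up to a polynomial factor.
Its size is slightly below N, and aperiodicity lets parts from the support of κ fill the deficit at
bounded cost. Here u solves a truncated saddle equation Σ_{j≤M} κ_j u^j = 1. The truncation is a
polynomial, so u may lie beyond R; hence the subcritical, critical and supercritical cases are
treated alike (`IsSaddle.eventually_exp_le`).

Multiplying the weight of cycles of length j by e^t raises the upper exponent by N(e^t - 1)κ_j
r_*^j/j up to o(N). By Jensen, t E_N[C_j]/N is at most (e^t - 1)κ_j r_*^j/j + o(1) for either sign
of t, and t → 0 identifies the limit of E_N[C_j]/N. Since Σ j C_j = N, the points in long cycles are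
the complement of finitely many such terms. -/

/-! ### Permutations sorted by cycle type -/

/-- The weight `∏_j (x_j / j)^{c_j} / c_j!` of a multiset with multiplicities `c_j`. -/
noncomputable def multisetWeight (x : ℕ → ℝ) (s : Multiset ℕ) : ℝ :=
  ∏ j ∈ s.toFinset, (x j / j) ^ s.count j / (s.count j).factorial

/-- The sum of the weights of all partitions of `n`. -/
noncomputable def partitionSum (x : ℕ → ℝ) (n : ℕ) : ℝ :=
  ∑ p : n.Partition, multisetWeight x p.parts

theorem multisetWeight_eq_prod (x : ℕ → ℝ) {s : Multiset ℕ} {S : Finset ℕ}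
    (h : s.toFinset ⊆ S) :
    multisetWeight x s = ∏ j ∈ S, (x j / j) ^ s.count j / (s.count j).factorial := by
  refine Finset.prod_subset h fun j _ hj => ?_
  have : s.count j = 0 := Multiset.count_eq_zero.2 fun hm => hj (Multiset.mem_toFinset.2 hm)
  simp [this]

theorem parts_toFinset_subset {n : ℕ} (p : n.Partition) : p.parts.toFinset ⊆ Finset.Icc 1 n := by
  intro j hj
  rw [Multiset.mem_toFinset] at hj
  rw [Finset.mem_Icc]
  refine ⟨p.parts_pos hj, ?_⟩
  rw [← p.parts_sum]
  exact Multiset.le_sum_of_mem hj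

theorem multisetWeight_nonneg {x : ℕ → ℝ} (hx : ∀ j, 1 ≤ j → 0 ≤ x j) {n : ℕ}
    (p : n.Partition) : 0 ≤ multisetWeight x p.parts := by
  refine Finset.prod_nonneg fun j hj => ?_
  have := hx j (Finset.mem_Icc.1 (parts_toFinset_subset p hj)).1
  positivity

theorem partitionSum_nonneg {x : ℕ → ℝ} (hx : ∀ j, 1 ≤ j → 0 ≤ x j) (n : ℕ) :
    0 ≤ partitionSum x n :=
  Finset.sum_nonneg fun p _ => multisetWeight_nonneg hx p

theorem sum_eq_sum_count {s : Multiset ℕ} {S : Finset ℕ} (h : s.toFinset ⊆ S) :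
    s.sum = ∑ j ∈ S, j * s.count j := by
  rw [Finset.sum_multiset_count_of_subset s S h]
  simp [mul_comm]

/-- `cycleType` forgets fixed points, but the number of parts equal to 1 is forced by the total. -/
theorem partition_eq_iff_cycleType {α : Type*} [Fintype α] [DecidableEq α]
    (σ : Equiv.Perm α) (p : (Fintype.card α).Partition) :
    σ.partition = p ↔ σ.cycleType = p.parts.filter (2 ≤ ·) := by
  constructor
  · rintro rfl
    exact σ.filter_parts_partition_eq_cycleType.symm
  · intro h
    have key : p.parts = p.parts.filter (2 ≤ ·) +
        Multiset.replicate (Fintype.card α - (p.parts.filter (2 ≤ ·)).sum) 1 := by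
      have h1 : p.parts.filter (fun j => ¬ 2 ≤ j) =
          Multiset.replicate (p.parts.filter (fun j => ¬ 2 ≤ j)).card 1 := by
        rw [Multiset.eq_replicate_card]
        intro b hb
        have := p.parts_pos (Multiset.mem_filter.1 hb).1
        have := (Multiset.mem_filter.1 hb).2
        omega
      have h2 := Multiset.filter_add_not (2 ≤ ·) p.parts
      have h3 : (p.parts.filter (2 ≤ ·)).sum +
          (p.parts.filter (fun j => ¬ 2 ≤ j)).card = Fintype.card α := by
        have := congrArg Multiset.sum h2
        rw [Multiset.sum_add, p.parts_sum, h1] at this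
        simpa using this
      conv_lhs => rw [← h2, h1]
      congr 2
      omega
    ext1
    rw [Equiv.Perm.parts_partition, ← Equiv.Perm.sum_cycleType, h]
    exact key.symm

/-- Cauchy's class size formula with fixed points counted as parts: the factor (n - m.sum)! in
`Equiv.Perm.card_of_cycleType_mul_eq` is exactly the contribution of the parts equal to 1. -/
theorem card_partition_eq_mul {α : Type*} [Fintype α] [DecidableEq α]
    (p : (Fintype.card α).Partition) :
    (Finset.univ.filter fun σ : Equiv.Perm α => σ.partition = p).card *
      ∏ j ∈ p.parts.toFinset, (j ^ p.parts.count j * (p.parts.count j).factorial) =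
      (Fintype.card α).factorial := by
  set m := p.parts.filter (2 ≤ ·) with hm
  have hle : m.sum ≤ Fintype.card α := by
    conv_rhs => rw [← p.parts_sum, ← Multiset.filter_add_not (2 ≤ ·) p.parts, Multiset.sum_add]
    exact Nat.le_add_right _ _
  have h := Equiv.Perm.card_of_cycleType_mul_eq α m
  rw [if_pos ⟨hle, fun a ha => (Multiset.mem_filter.1 ha).2⟩] at h
  rw [← h]
  simp_rw [partition_eq_iff_cycleType]
  congr 1
  have hsub : p.parts.toFinset ⊆ insert 1 m.toFinset := by
    intro j hj
    rw [Multiset.mem_toFinset] at hj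
    have := p.parts_pos hj
    by_cases h2 : 2 ≤ j
    · exact Finset.mem_insert_of_mem (Multiset.mem_toFinset.2 (Multiset.mem_filter.2 ⟨hj, h2⟩))
    · exact Finset.mem_insert.2 (Or.inl (by omega))
  have hnot : (1 : ℕ) ∉ m.toFinset := by
    simp [hm]
  have hcount : ∀ j ∈ m.toFinset, p.parts.count j = m.count j := by
    intro j hj
    rw [hm, Multiset.count_filter_of_pos (Multiset.mem_filter.1 (Multiset.mem_toFinset.1 hj)).2]
  have hone : p.parts.count 1 = Fintype.card α - m.sum := by
    have h1 := sum_eq_sum_count hsub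
    rw [p.parts_sum, Finset.sum_insert hnot, Finset.sum_congr rfl
      (fun j hj => by rw [hcount j hj]), ← sum_eq_sum_count (Finset.Subset.refl m.toFinset)] at h1
    omega
  rw [Finset.prod_subset hsub (fun j _ hj => by
    have : p.parts.count j = 0 :=
      Multiset.count_eq_zero.2 fun hm => hj (Multiset.mem_toFinset.2 hm)
    simp [this]), Finset.prod_insert hnot, hone, Finset.prod_congr rfl
      (fun j hj => by rw [hcount j hj]), Finset.prod_mul_distrib,
      ← Finset.prod_multiset_count]
  ring

theorem sum_perm_eq_sum_partition {α : Type*} [Fintype α] [DecidableEq α] (x : ℕ → ℝ) :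
    ∑ σ : Equiv.Perm α, ∏ j ∈ Finset.Icc 1 (Fintype.card α), x j ^ σ.partition.parts.count j =
      (Fintype.card α).factorial * partitionSum x (Fintype.card α) := by
  rw [← Finset.sum_fiberwise_of_maps_to (s := Finset.univ) (t := Finset.univ)
    (g := fun σ : Equiv.Perm α => σ.partition) (fun _ _ => Finset.mem_univ _), partitionSum,
    Finset.mul_sum]
  refine Finset.sum_congr rfl fun p _ => ?_
  rw [Finset.sum_congr rfl (g := fun _ => ∏ j ∈ p.parts.toFinset, x j ^ p.parts.count j)]
  · rw [Finset.sum_const, nsmul_eq_mul, ← card_partition_eq_mul p, multisetWeight]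
    push_cast
    rw [mul_assoc, ← Finset.prod_mul_distrib]
    congr 1
    refine Finset.prod_congr rfl fun j hj => ?_
    have : (j : ℝ) ≠ 0 := by
      have := p.parts_pos (Multiset.mem_toFinset.1 hj)
      positivity
    rw [div_pow]
    field_simp
  · intro σ hσ
    rw [(Finset.mem_filter.1 hσ).2]
    refine (Finset.prod_subset (parts_toFinset_subset p) fun j _ hj => ?_).symm
    have : p.parts.count j = 0 :=
      Multiset.count_eq_zero.2 fun hm => hj (Multiset.mem_toFinset.2 hm)
    simp [this]

theorem partitionSum_eq (x : ℕ → ℝ) (N : ℕ) :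
    partitionSum x N = (1 / (N.factorial : ℝ)) *
      ∑ σ : Equiv.Perm (Fin N), ∏ j ∈ Finset.Icc 1 N, x j ^ cycleCount σ j := by
  have h := sum_perm_eq_sum_partition (α := Fin N) x
  simp only [Fintype.card_fin] at h
  have : (N.factorial : ℝ) ≠ 0 := by positivity
  unfold cycleCount
  rw [h]
  field_simp

theorem sum_mul_cycleCount {N : ℕ} (σ : Equiv.Perm (Fin N)) :
    ∑ j ∈ Finset.Icc 1 N, j * cycleCount σ j = N := by
  have h := parts_toFinset_subset σ.partition
  have h2 := sum_eq_sum_count h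
  rw [σ.partition.parts_sum] at h2
  simp only [Fintype.card_fin] at h2
  exact h2.symm

/-! ### Bounds for partition sums -/

/-- Write r^n as ∏ r^{j c_j} and drop the constraint Σ j c_j = n: the sum over all multiplicity
vectors in a box factorises into truncated exponential series. -/
theorem partitionSum_mul_pow_le {x : ℕ → ℝ} (hx : ∀ j, 1 ≤ j → 0 ≤ x j) {r : ℝ} (hr : 0 ≤ r)
    (n : ℕ) :
    partitionSum x n * r ^ n ≤ Real.exp (∑ j ∈ Finset.Icc 1 n, x j / j * r ^ j) := by
  set y : ℕ → ℝ := fun j => x j / j * r ^ j with hy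
  have hy0 : ∀ j, 1 ≤ j → 0 ≤ y j := fun j hj => by
    have := hx j hj
    positivity
  have h1 : ∀ p : n.Partition, multisetWeight x p.parts * r ^ n =
      ∏ j : Finset.Icc 1 n, y j ^ p.parts.count j.1 / (p.parts.count j.1).factorial := by
    intro p
    rw [multisetWeight_eq_prod x (parts_toFinset_subset p), Finset.prod_coe_sort (Finset.Icc 1 n)
      (fun j => y j ^ p.parts.count j / (p.parts.count j).factorial)]
    have h2 : r ^ n = ∏ j ∈ Finset.Icc 1 n, r ^ (j * p.parts.count j) := by
      rw [Finset.prod_pow_eq_pow_sum, ← sum_eq_sum_count (parts_toFinset_subset p), p.parts_sum]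
    rw [h2, ← Finset.prod_mul_distrib]
    refine Finset.prod_congr rfl fun j _ => ?_
    rw [hy, mul_pow, ← pow_mul]
    ring
  have hcle : ∀ (p : n.Partition) (j : Finset.Icc 1 n), p.parts.count j.1 < n + 1 := by
    intro p j
    have h3 := sum_eq_sum_count (parts_toFinset_subset p)
    rw [p.parts_sum] at h3
    have h4 : j.1 * p.parts.count j.1 ≤ n := by
      conv_rhs => rw [h3]
      exact Finset.single_le_sum (f := fun i => i * p.parts.count i)
        (fun _ _ => Nat.zero_le _) j.2
    have h5 := (Finset.mem_Icc.1 j.2).1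
    nlinarith
  calc partitionSum x n * r ^ n
      = ∑ p : n.Partition,
          ∏ j : Finset.Icc 1 n, y j ^ p.parts.count j.1 / (p.parts.count j.1).factorial := by
        rw [partitionSum, Finset.sum_mul]
        exact Finset.sum_congr rfl fun p _ => h1 p
    _ = ∑ c ∈ Finset.univ.image (fun (p : n.Partition) (j : Finset.Icc 1 n) =>
          p.parts.count j.1), ∏ j : Finset.Icc 1 n, y j ^ c j / (c j).factorial := by
        rw [Finset.sum_image]
        intro p _ q _ hpq
        ext1
        ext j
        by_cases hj : j ∈ Finset.Icc 1 n
        · exact congrFun hpq ⟨j, hj⟩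
        · rw [Multiset.count_eq_zero.2 fun h =>
              hj (parts_toFinset_subset p (Multiset.mem_toFinset.2 h)),
            Multiset.count_eq_zero.2 fun h =>
              hj (parts_toFinset_subset q (Multiset.mem_toFinset.2 h))]
    _ ≤ ∑ c ∈ Fintype.piFinset (fun _ : Finset.Icc 1 n => Finset.range (n + 1)),
          ∏ j : Finset.Icc 1 n, y j ^ c j / (c j).factorial := by
        refine Finset.sum_le_sum_of_subset_of_nonneg ?_ fun c _ _ => ?_
        · intro c hc
          obtain ⟨p, _, rfl⟩ := Finset.mem_image.1 hc
          exact Fintype.mem_piFinset.2 fun j => Finset.mem_range.2 (hcle p j)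
        · refine Finset.prod_nonneg fun j _ => ?_
          have := hy0 j.1 (Finset.mem_Icc.1 j.2).1
          positivity
    _ = ∏ j : Finset.Icc 1 n, ∑ c ∈ Finset.range (n + 1), y j ^ c / c.factorial := by
        rw [Finset.prod_univ_sum]
    _ ≤ ∏ j : Finset.Icc 1 n, Real.exp (y j) := by
        refine Finset.prod_le_prod (fun j _ => ?_) fun j _ => ?_
        · refine Finset.sum_nonneg fun c _ => ?_
          have := hy0 j.1 (Finset.mem_Icc.1 j.2).1
          positivity
        · exact Real.sum_le_exp_of_nonneg (hy0 j.1 (Finset.mem_Icc.1 j.2).1) _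
    _ = Real.exp (∑ j ∈ Finset.Icc 1 n, x j / j * r ^ j) := by
        rw [Finset.prod_coe_sort (Finset.Icc 1 n) (fun j => Real.exp (y j)), Real.exp_sum]

theorem prod_le_partitionSum {x : ℕ → ℝ} (hx : ∀ j, 1 ≤ j → 0 ≤ x j) (M : ℕ) (c : ℕ → ℕ) :
    ∏ j ∈ Finset.Icc 1 M, (x j / j) ^ c j / (c j).factorial ≤
      partitionSum x (∑ j ∈ Finset.Icc 1 M, j * c j) := by
  set s : Multiset ℕ := ∑ j ∈ Finset.Icc 1 M, Multiset.replicate (c j) j with hs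
  have hcount : ∀ j, s.count j = if j ∈ Finset.Icc 1 M then c j else 0 := by
    intro j
    rw [hs, Multiset.count_sum']
    simp_rw [Multiset.count_replicate]
    rw [Finset.sum_ite_eq']
  have hmem : ∀ j, j ∈ s → j ∈ Finset.Icc 1 M := by
    intro j hj
    by_contra h
    have := Multiset.count_pos.2 hj
    rw [hcount, if_neg h] at this
    exact lt_irrefl _ this
  have hsub : s.toFinset ⊆ Finset.Icc 1 M := fun j hj => hmem j (Multiset.mem_toFinset.1 hj)
  let p : (∑ j ∈ Finset.Icc 1 M, j * c j).Partition :=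
    { parts := s
      parts_pos := fun {j} hj => (Finset.mem_Icc.1 (hmem j hj)).1
      parts_sum := by
        rw [sum_eq_sum_count hsub]
        exact Finset.sum_congr rfl fun j hj => by rw [hcount, if_pos hj] }
  have hp : multisetWeight x p.parts =
      ∏ j ∈ Finset.Icc 1 M, (x j / j) ^ c j / (c j).factorial := by
    rw [multisetWeight_eq_prod x hsub]
    exact Finset.prod_congr rfl fun j hj => by
      rw [hcount, if_pos hj]
  rw [← hp]
  exact Finset.single_le_sum (f := fun p : Nat.Partition _ => multisetWeight x p.parts)
    (fun q _ => multisetWeight_nonneg hx q) (Finset.mem_univ p)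

/-- Adding a part j is injective on partitions and multiplies the weight by x_j/(j(c_j + 1)). Since
j(c_j + 1) is at most the new total n + j, the loss is controlled. -/
theorem mul_partitionSum_le {x : ℕ → ℝ} (hx : ∀ j, 1 ≤ j → 0 ≤ x j) {j : ℕ} (hj : 1 ≤ j)
    (n : ℕ) : x j / (n + j : ℕ) * partitionSum x n ≤ partitionSum x (n + j) := by
  let f : n.Partition → (n + j).Partition := fun p =>
    { parts := j ::ₘ p.parts
      parts_pos := fun {i} hi => by
        rcases Multiset.mem_cons.1 hi with rfl | h
        · exact hj
        · exact p.parts_pos h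
      parts_sum := by rw [Multiset.sum_cons, p.parts_sum, add_comm] }
  have hf : Function.Injective f := by
    intro p q h
    ext1
    exact (Multiset.cons_inj_right j).1 (congrArg Nat.Partition.parts h)
  have hw : ∀ p : n.Partition, x j / (n + j : ℕ) * multisetWeight x p.parts ≤
      multisetWeight x (f p).parts := by
    intro p
    have hsub := parts_toFinset_subset (f p)
    have hsub' : p.parts.toFinset ⊆ Finset.Icc 1 (n + j) :=
      (parts_toFinset_subset p).trans (Finset.Icc_subset_Icc_right (Nat.le_add_right _ _))
    have hjm : j ∈ Finset.Icc 1 (n + j) := Finset.mem_Icc.2 ⟨hj, Nat.le_add_left _ _⟩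
    rw [multisetWeight_eq_prod x hsub, multisetWeight_eq_prod x hsub',
      ← Finset.mul_prod_erase _ _ hjm, ← Finset.mul_prod_erase _ _ hjm, ← mul_assoc]
    have hc : (f p).parts.count j = p.parts.count j + 1 := Multiset.count_cons_self _ _
    have hprod : ∏ i ∈ (Finset.Icc 1 (n + j)).erase j,
          (x i / i) ^ (f p).parts.count i / ((f p).parts.count i).factorial =
        ∏ i ∈ (Finset.Icc 1 (n + j)).erase j,
          (x i / i) ^ p.parts.count i / (p.parts.count i).factorial := by
      refine Finset.prod_congr rfl fun i hi => ?_
      have : (f p).parts.count i = p.parts.count i :=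
        Multiset.count_cons_of_ne (Finset.mem_erase.1 hi).1 _
      rw [this]
    rw [hprod, hc]
    refine mul_le_mul_of_nonneg_right ?_ (Finset.prod_nonneg fun i hi => ?_)
    · have hle : j * (p.parts.count j + 1) ≤ n + j := by
        have h3 := sum_eq_sum_count hsub
        rw [(f p).parts_sum] at h3
        rw [← hc]
        conv_rhs => rw [h3]
        exact Finset.single_le_sum (f := fun i => i * (f p).parts.count i)
          (fun _ _ => Nat.zero_le _) hjm
      have hle' : (j : ℝ) * (p.parts.count j + 1) ≤ (n + j : ℕ) := by exact_mod_cast hle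
      have hxj := hx j hj
      have hj' : (0 : ℝ) < j := by exact_mod_cast hj
      rw [pow_succ, Nat.factorial_succ]
      push_cast
      calc x j / ((n : ℝ) + j) * ((x j / j) ^ p.parts.count j / (p.parts.count j).factorial)
          ≤ x j / ((j : ℝ) * (p.parts.count j + 1)) *
            ((x j / j) ^ p.parts.count j / (p.parts.count j).factorial) := by
            push_cast at hle'
            gcongr
        _ = _ := by field_simp
    · have := hx i (Finset.mem_Icc.1 (Finset.mem_erase.1 hi).2).1
      positivity
  rw [partitionSum, Finset.mul_sum]
  calc ∑ p : n.Partition, x j / (n + j : ℕ) * multisetWeight x p.parts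
      ≤ ∑ p : n.Partition, multisetWeight x (f p).parts := Finset.sum_le_sum fun p _ => hw p
    _ = ∑ q ∈ Finset.univ.image f, multisetWeight x q.parts := by
        rw [Finset.sum_image fun p _ q _ h => hf h]
    _ ≤ partitionSum x (n + j) :=
        Finset.sum_le_sum_of_subset_of_nonneg (Finset.subset_univ _)
          fun q _ _ => multisetWeight_nonneg hx q

/-- A crude Stirling bound; the induction step is e ≤ (1 + 1/c)^{c+1}. -/
theorem factorial_le_pow_mul_exp {c : ℕ} (hc : 1 ≤ c) :
    (c.factorial : ℝ) ≤ (c : ℝ) ^ (c + 1) * Real.exp (1 - c) := by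
  induction c, hc using Nat.le_induction with
  | base => simp
  | succ c hc ih =>
    have hc0 : (0 : ℝ) < c := by exact_mod_cast hc
    have h1 : Real.exp 1 ≤ (((c : ℝ) + 1) / c) ^ (c + 1) := by
      have h2 := Real.one_sub_inv_le_log_of_pos (x := ((c : ℝ) + 1) / c) (by positivity)
      have h3 : 1 ≤ ((c : ℝ) + 1) * Real.log (((c : ℝ) + 1) / c) := by
        calc (1 : ℝ) = ((c : ℝ) + 1) * (1 - (((c : ℝ) + 1) / c)⁻¹) := by field_simp; ring
          _ ≤ _ := by gcongr
      calc Real.exp 1 ≤ Real.exp (((c : ℝ) + 1) * Real.log (((c : ℝ) + 1) / c)) :=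
            Real.exp_le_exp.2 h3
        _ = (((c : ℝ) + 1) / c) ^ (c + 1) := by
            rw [← Real.exp_log (x := (((c : ℝ) + 1) / c) ^ (c + 1)) (by positivity), Real.log_pow]
            push_cast
            rfl
    have h4 : (c : ℝ) ^ (c + 1) * Real.exp 1 ≤ ((c : ℝ) + 1) ^ (c + 1) := by
      rw [div_pow, le_div_iff₀ (by positivity)] at h1
      linarith
    rw [Nat.factorial_succ]
    push_cast
    have h5 : Real.exp (1 - c) = Real.exp 1 * Real.exp (1 - ((c : ℝ) + 1)) := by
      rw [← Real.exp_add]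
      congr 1
      ring
    calc ((c : ℝ) + 1) * c.factorial
        ≤ ((c : ℝ) + 1) * ((c : ℝ) ^ (c + 1) * Real.exp (1 - c)) := by gcongr
      _ = ((c : ℝ) + 1) * ((c : ℝ) ^ (c + 1) * Real.exp 1) * Real.exp (1 - ((c : ℝ) + 1)) := by
          rw [h5]; ring
      _ ≤ ((c : ℝ) + 1) * ((c : ℝ) + 1) ^ (c + 1) * Real.exp (1 - ((c : ℝ) + 1)) := by gcongr
      _ = _ := by ring

/-- The exponential series is dominated, up to a linear factor, by its term of index ⌊y⌋. This is
why rounding the ideal multiplicities down costs only a polynomial factor. -/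
theorem exp_le_mul_pow_floor_div_factorial {y : ℝ} (hy : 0 ≤ y) :
    Real.exp y ≤ Real.exp 2 * (y + 1) * (y ^ ⌊y⌋₊ / (⌊y⌋₊).factorial) := by
  rcases Nat.eq_zero_or_pos ⌊y⌋₊ with h0 | h0
  · rw [h0]
    have h1 : y < 1 := Nat.floor_eq_zero.1 h0
    have h2 : Real.exp y ≤ Real.exp 2 := Real.exp_le_exp.2 (by linarith)
    simp only [pow_zero, Nat.factorial_zero, Nat.cast_one, div_one, mul_one]
    nlinarith [Real.exp_pos 2]
  · set c := ⌊y⌋₊ with hc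
    have hc0 : (0 : ℝ) < c := by exact_mod_cast h0
    have hcy : (c : ℝ) ≤ y := Nat.floor_le hy
    have hyc : y < c + 1 := Nat.lt_floor_add_one y
    rw [← mul_div_assoc, le_div_iff₀ (by positivity)]
    calc Real.exp y * c.factorial
        ≤ Real.exp (c + 1) * ((c : ℝ) ^ (c + 1) * Real.exp (1 - c)) := by
          have := factorial_le_pow_mul_exp h0
          gcongr
      _ = Real.exp 2 * (c * (c : ℝ) ^ c) := by
          have : Real.exp 2 = Real.exp (c + 1) * Real.exp (1 - c) := by
            rw [← Real.exp_add]
            congr 1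
            ring
          rw [this]
          ring
      _ ≤ Real.exp 2 * ((y + 1) * y ^ c) := by
          gcongr
          linarith
      _ = _ := by ring

/-! ### Exponential lower bound for the normalisation -/

/-- The cycle weights `θ_j + N κ_j` of the surrogate-spatial measure. -/
def cycleWeight (θ κ : ℕ → ℝ) (N j : ℕ) : ℝ := θ j + N * κ j

theorem cycleWeight_nonneg {θ κ : ℕ → ℝ} (hθ : ∀ j : ℕ, 1 ≤ j → 0 ≤ θ j)
    (hκ : ∀ j : ℕ, 1 ≤ j → 0 ≤ κ j) (N : ℕ) : ∀ j, 1 ≤ j → 0 ≤ cycleWeight θ κ N j := by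
  intro j hj
  have := hθ j hj
  have := hκ j hj
  unfold cycleWeight
  positivity

/-- While the total stays at most N, inserting a part j costs a factor at least Nκ_j/N = κ_j. The
constant is therefore independent of N, and costs multiply along sums of support elements. -/
theorem exists_mul_partitionSum_le_of_mem_closure {θ κ : ℕ → ℝ}
    (hθ : ∀ j : ℕ, 1 ≤ j → 0 ≤ θ j) (hκ : ∀ j : ℕ, 1 ≤ j → 0 ≤ κ j) {d : ℕ}
    (hd : d ∈ AddSubmonoid.closure {j : ℕ | 1 ≤ j ∧ κ j ≠ 0}) :
    ∃ c : ℝ, 0 < c ∧ ∀ N n : ℕ, n + d ≤ N →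
      c * partitionSum (cycleWeight θ κ N) n ≤ partitionSum (cycleWeight θ κ N) (n + d) := by
  induction hd using AddSubmonoid.closure_induction with
  | mem j hj =>
    have hpos : 0 < κ j := lt_of_le_of_ne (hκ j hj.1) (Ne.symm hj.2)
    refine ⟨κ j, hpos, fun N n hN => ?_⟩
    refine le_trans ?_ (mul_partitionSum_le (cycleWeight_nonneg hθ hκ N) hj.1 n)
    refine mul_le_mul_of_nonneg_right ?_ (partitionSum_nonneg (cycleWeight_nonneg hθ hκ N) n)
    have h1 : 0 < n + j := by have := hj.1; omega
    have h2 : ((n + j : ℕ) : ℝ) ≤ N := by exact_mod_cast hN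
    rw [le_div_iff₀ (by exact_mod_cast h1), cycleWeight]
    have := hθ j hj.1
    nlinarith
  | zero => exact ⟨1, one_pos, fun N n _ => by simp⟩
  | add a b _ _ iha ihb =>
    obtain ⟨c, hc, hc'⟩ := iha
    obtain ⟨e, he, he'⟩ := ihb
    refine ⟨e * c, mul_pos he hc, fun N n hN => ?_⟩
    calc e * c * partitionSum (cycleWeight θ κ N) n
        = e * (c * partitionSum (cycleWeight θ κ N) n) := by ring
      _ ≤ e * partitionSum (cycleWeight θ κ N) (n + a) := by
          have := hc' N n (by omega)
          gcongr
      _ ≤ partitionSum (cycleWeight θ κ N) (n + a + b) := he' N (n + a) (by omega)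
      _ = _ := by rw [add_assoc]

/-- Aperiodicity says that the support of κ has gcd 1, and a numerical semigroup with gcd 1 contains
all large integers. -/
theorem exists_forall_ge_mem_closure {κ : ℕ → ℝ}
    (h : ¬ ∃ d : ℕ, 1 < d ∧ ∀ j : ℕ, 1 ≤ j → κ j ≠ 0 → d ∣ j)
    (hne : ∃ j : ℕ, 1 ≤ j ∧ κ j ≠ 0) :
    ∃ n₀ : ℕ, ∀ m ≥ n₀, m ∈ AddSubmonoid.closure {j : ℕ | 1 ≤ j ∧ κ j ≠ 0} := by
  obtain ⟨n₀, hn⟩ := Nat.exists_mem_closure_of_ge {j : ℕ | 1 ≤ j ∧ κ j ≠ 0}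
  refine ⟨n₀, fun m hm => hn m hm ?_⟩
  have hg : Nat.setGcd {j : ℕ | 1 ≤ j ∧ κ j ≠ 0} = 1 := by
    set g := Nat.setGcd {j : ℕ | 1 ≤ j ∧ κ j ≠ 0} with hgdef
    have hdvd : ∀ j : ℕ, 1 ≤ j → κ j ≠ 0 → g ∣ j := fun j h1 h2 => Nat.setGcd_dvd_of_mem ⟨h1, h2⟩
    -- The gcd of a set without positive elements is 0, which must be excluded before concluding g =
    -- 1.
    have h0 : g ≠ 0 := by
      obtain ⟨j, hj1, hj2⟩ := hne
      intro h0
      have := hdvd j hj1 hj2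
      rw [h0, zero_dvd_iff] at this
      omega
    by_contra h1
    exact h ⟨g, by omega, hdvd⟩
  rw [hg]
  exact one_dvd m

theorem exists_pos_forall_le {α : Type*} (s : Finset α) (f : α → ℝ) (hf : ∀ a ∈ s, 0 < f a) :
    ∃ C : ℝ, 0 < C ∧ ∀ a ∈ s, C ≤ f a := by
  rcases s.eq_empty_or_nonempty with rfl | hs
  · exact ⟨1, one_pos, by simp⟩
  · obtain ⟨a, ha, hmin⟩ := s.exists_min_image f hs
    exact ⟨f a, hf a ha, hmin⟩

theorem exists_le_partitionSum {θ κ : ℕ → ℝ}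
    (hθ : ∀ j : ℕ, 1 ≤ j → 0 ≤ θ j) (hκ : ∀ j : ℕ, 1 ≤ j → 0 ≤ κ j) {n₀ : ℕ}
    (hn₀ : ∀ m ≥ n₀, m ∈ AddSubmonoid.closure {j : ℕ | 1 ≤ j ∧ κ j ≠ 0})
    {M : ℕ} {u : ℝ} (hu : 0 < u) (hsum : ∑ j ∈ Finset.Icc 1 M, κ j * u ^ j = 1) :
    ∃ C : ℝ, 0 < C ∧ ∀ N : ℕ, n₀ ≤ N →
      C * Real.exp (N * (∑ j ∈ Finset.Icc 1 M, κ j / j * u ^ j)) / u ^ N ≤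
        (Real.exp 2 * (N + 1)) ^ M * partitionSum (cycleWeight θ κ N) N := by
  set A := ∑ j ∈ Finset.Icc 1 M, κ j / j * u ^ j with hA
  have hex : ∀ d : ℕ, ∃ c : ℝ, 0 < c ∧ (n₀ ≤ d → ∀ N n : ℕ, n + d ≤ N →
      c * partitionSum (cycleWeight θ κ N) n ≤ partitionSum (cycleWeight θ κ N) (n + d)) := by
    intro d
    by_cases hd : n₀ ≤ d
    · obtain ⟨c, hc, h⟩ := exists_mul_partitionSum_le_of_mem_closure hθ hκ (hn₀ d hd)
      exact ⟨c, hc, fun _ => h⟩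
    -- A dummy value: only deficits d ≥ n₀ occur below.
    · exact ⟨1, one_pos, fun h => absurd h hd⟩
  choose c hc hcle using hex
  set B := ∑ j ∈ Finset.Icc 1 M, j with hB
  -- Rounding loses at most B = 1 + ... + M points and n₀ points are held back, so only the finitely
  -- many deficits d ≤ n₀ + B arise and one constant serves all N.
  obtain ⟨C, hC, hCle⟩ := exists_pos_forall_le (Finset.range (n₀ + B + 1))
    (fun d => c d * u ^ d) (fun d _ => mul_pos (hc d) (pow_pos hu d))
  -- The extra factor trades the exponent NA for N'A, where N' = N - n₀. Working with N' keeps the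
  -- final deficit at least n₀, hence inside the semigroup.
  refine ⟨C * Real.exp (-(n₀ * A)), mul_pos hC (Real.exp_pos _), fun N hN => ?_⟩
  obtain ⟨N', rfl⟩ := Nat.exists_eq_add_of_le' hN
  set α : ℕ → ℝ := fun j => κ j / j * u ^ j with hα
  have hα0 : ∀ j ∈ Finset.Icc 1 M, 0 ≤ α j := fun j hj => by
    have := hκ j (Finset.mem_Icc.1 hj).1
    positivity
  set k : ℕ → ℕ := fun j => ⌊N' * α j⌋₊ with hk
  set n := ∑ j ∈ Finset.Icc 1 M, j * k j with hn
  have hαj : ∀ j ∈ Finset.Icc 1 M, (j : ℝ) * α j = κ j * u ^ j := fun j hj => by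
    have : (j : ℝ) ≠ 0 := by
      have := (Finset.mem_Icc.1 hj).1
      positivity
    simp only [hα]
    field_simp
  -- The saddle equation makes the unrounded multiplicities N'α_j sum, with weights j, exactly to
  -- N'.
  have hsumα : ∑ j ∈ Finset.Icc 1 M, (j : ℝ) * (N' * α j) = N' := by
    rw [Finset.sum_congr rfl (g := fun j => (N' : ℝ) * (κ j * u ^ j)) fun j hj => by
      rw [← hαj j hj]; ring]
    rw [← Finset.mul_sum, hsum, mul_one]
  have hnle : n ≤ N' := by
    have : (n : ℝ) ≤ N' := by
      rw [hn, ← hsumα]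
      push_cast
      refine Finset.sum_le_sum fun j hj => ?_
      have := Nat.floor_le (mul_nonneg (Nat.cast_nonneg N') (hα0 j hj))
      gcongr
    exact_mod_cast this
  have hnge : N' ≤ n + B := by
    have : (N' : ℝ) ≤ (n + B : ℕ) := by
      conv_lhs => rw [← hsumα]
      rw [hn, hB]
      push_cast
      rw [← Finset.sum_add_distrib]
      refine Finset.sum_le_sum fun j hj => ?_
      have := (Nat.lt_floor_add_one ((N' : ℝ) * α j)).le
      calc (j : ℝ) * (N' * α j) ≤ j * (k j + 1) := by gcongr
        _ = _ := by ring
    exact_mod_cast this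
  have hα1 : ∀ j ∈ Finset.Icc 1 M, α j ≤ 1 := fun j hj => by
    have h1 : κ j * u ^ j ≤ 1 := by
      rw [← hsum]
      refine Finset.single_le_sum (f := fun j => κ j * u ^ j) (fun i hi => ?_) hj
      have := hκ i (Finset.mem_Icc.1 hi).1
      positivity
    have h2 : (1 : ℝ) ≤ j := by exact_mod_cast (Finset.mem_Icc.1 hj).1
    have := hα0 j hj
    nlinarith [hαj j hj]
  have hx := cycleWeight_nonneg hθ hκ (N' + n₀)
  have hT : Real.exp (N' * A) ≤ (Real.exp 2 * ((N' + n₀ : ℕ) + 1)) ^ M * u ^ n *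
      partitionSum (cycleWeight θ κ (N' + n₀)) n := by
    have h1 : (Real.exp 2 * ((N' + n₀ : ℕ) + 1)) ^ M =
        ∏ _j ∈ Finset.Icc 1 M, (Real.exp 2 * (((N' + n₀ : ℕ) : ℝ) + 1)) := by
      rw [Finset.prod_const, Nat.card_Icc, Nat.add_sub_cancel]
    have h2 : u ^ n = ∏ j ∈ Finset.Icc 1 M, u ^ (j * k j) := by
      rw [Finset.prod_pow_eq_pow_sum]
    refine le_trans ?_ (mul_le_mul_of_nonneg_left (prod_le_partitionSum hx M k) (by positivity))
    rw [h1, h2, hA, Finset.mul_sum, Real.exp_sum, ← Finset.prod_mul_distrib,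
      ← Finset.prod_mul_distrib]
    refine Finset.prod_le_prod (fun _ _ => (Real.exp_pos _).le) fun j hj => ?_
    have hy : 0 ≤ (N' : ℝ) * α j := mul_nonneg (Nat.cast_nonneg _) (hα0 j hj)
    refine (exp_le_mul_pow_floor_div_factorial hy).trans ?_
    have h3 : (N' : ℝ) * α j + 1 ≤ ((N' + n₀ : ℕ) : ℝ) + 1 := by
      push_cast
      have := hα1 j hj
      have h4 : (0 : ℝ) ≤ N' := Nat.cast_nonneg _
      have h5 : (0 : ℝ) ≤ n₀ := Nat.cast_nonneg _
      nlinarith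
    have hj1 := (Finset.mem_Icc.1 hj).1
    have h6 : (N' : ℝ) * α j ≤ cycleWeight θ κ (N' + n₀) j / j * u ^ j := by
      simp only [hα, cycleWeight]
      rw [← mul_assoc, ← mul_div_assoc]
      have h7 := hθ j hj1
      have h8 := hκ j hj1
      gcongr
      push_cast
      have h5 : (0 : ℝ) ≤ n₀ := Nat.cast_nonneg _
      nlinarith
    calc Real.exp 2 * (N' * α j + 1) * ((N' * α j) ^ k j / (k j).factorial)
        ≤ Real.exp 2 * (((N' + n₀ : ℕ) : ℝ) + 1) *
          ((cycleWeight θ κ (N' + n₀) j / j * u ^ j) ^ k j / (k j).factorial) := by gcongr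
      _ = _ := by
          rw [mul_pow, ← pow_mul]
          ring
  set d := N' + n₀ - n with hd
  have hnd : n + d = N' + n₀ := by omega
  have hstep := hcle d (by omega) (N' + n₀) n hnd.le
  have hCd := hCle d (Finset.mem_range.2 (by omega))
  rw [hnd] at hstep
  rw [div_le_iff₀ (pow_pos hu _)]
  have hexp : Real.exp (-(n₀ * A)) * Real.exp ((N' + n₀ : ℕ) * A) = Real.exp (N' * A) := by
    rw [← Real.exp_add]
    congr 1
    push_cast
    ring
  set P := (Real.exp 2 * (((N' + n₀ : ℕ) : ℝ) + 1)) ^ M with hP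
  have hP0 : 0 ≤ P := by positivity
  calc C * Real.exp (-(n₀ * A)) * Real.exp ((N' + n₀ : ℕ) * A)
      = C * Real.exp (N' * A) := by rw [mul_assoc, hexp]
    _ ≤ (c d * u ^ d) * (P * u ^ n * partitionSum (cycleWeight θ κ (N' + n₀)) n) :=
        mul_le_mul hCd hT (Real.exp_pos _).le (mul_nonneg (hc d).le (by positivity))
    _ = P * (c d * partitionSum (cycleWeight θ κ (N' + n₀)) n) * u ^ (n + d) := by
        rw [pow_add]
        ring
    _ ≤ P * partitionSum (cycleWeight θ κ (N' + n₀)) (N' + n₀) * u ^ (N' + n₀) := by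
        rw [hnd]
        gcongr

theorem eventually_pow_le_mul_exp {C ε : ℝ} (hC : 0 < C) (hε : 0 < ε) (M : ℕ) :
    ∀ᶠ N : ℕ in atTop, (Real.exp 2 * ((N : ℝ) + 1)) ^ M ≤ C * Real.exp (N * ε) := by
  have h1 : (fun x : ℝ => x ^ M) =o[atTop] fun x => Real.exp (ε * x) :=
    isLittleO_pow_exp_pos_mul_atTop M hε
  have hpos : 0 < C / (Real.exp 2 ^ M * Real.exp ε) := by positivity
  have h2 := h1.bound hpos
  have h3 : Tendsto (fun N : ℕ => (N : ℝ) + 1) atTop atTop :=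
    tendsto_atTop_add_const_right _ _ tendsto_natCast_atTop_atTop
  filter_upwards [h3.eventually h2] with N hN
  rw [Real.norm_of_nonneg (by positivity), Real.norm_of_nonneg (by positivity)] at hN
  calc (Real.exp 2 * ((N : ℝ) + 1)) ^ M = Real.exp 2 ^ M * ((N : ℝ) + 1) ^ M := mul_pow _ _ _
    _ ≤ Real.exp 2 ^ M * (C / (Real.exp 2 ^ M * Real.exp ε) * Real.exp (ε * (N + 1))) := by gcongr
    _ = C * Real.exp (N * ε) := by
        have : Real.exp (ε * ((N : ℝ) + 1)) = Real.exp (N * ε) * Real.exp ε := by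
          rw [← Real.exp_add]
          congr 1
          ring
        rw [this]
        field_simp

theorem eventually_exp_le_partitionSum {θ κ : ℕ → ℝ}
    (hθ : ∀ j : ℕ, 1 ≤ j → 0 ≤ θ j) (hκ : ∀ j : ℕ, 1 ≤ j → 0 ≤ κ j) {n₀ : ℕ}
    (hn₀ : ∀ m ≥ n₀, m ∈ AddSubmonoid.closure {j : ℕ | 1 ≤ j ∧ κ j ≠ 0})
    {M : ℕ} {u : ℝ} (hu : 0 < u) (hsum : ∑ j ∈ Finset.Icc 1 M, κ j * u ^ j = 1)
    {ε : ℝ} (hε : 0 < ε) :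
    ∀ᶠ N : ℕ in atTop,
      Real.exp (N * ((∑ j ∈ Finset.Icc 1 M, κ j / j * u ^ j) - Real.log u - ε)) ≤
        partitionSum (cycleWeight θ κ N) N := by
  obtain ⟨C, hC, h⟩ := exists_le_partitionSum hθ hκ hn₀ hu hsum
  filter_upwards [eventually_ge_atTop n₀, eventually_pow_le_mul_exp hC hε M] with N hN hpow
  set A := ∑ j ∈ Finset.Icc 1 M, κ j / j * u ^ j with hA
  have h1 := h N hN
  have hS := partitionSum_nonneg (cycleWeight_nonneg hθ hκ N) N
  have h2 : C * Real.exp (N * A) / u ^ N ≤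
      C * Real.exp (N * ε) * partitionSum (cycleWeight θ κ N) N :=
    h1.trans (mul_le_mul_of_nonneg_right hpow hS)
  have h3 : Real.exp (N * (A - Real.log u - ε)) =
      Real.exp (N * A) / u ^ N / Real.exp (N * ε) := by
    rw [← Real.exp_log (pow_pos hu N), Real.log_pow, ← Real.exp_sub, ← Real.exp_sub]
    congr 1
    ring
  rw [h3, div_le_iff₀ (Real.exp_pos _)]
  rw [mul_div_assoc, mul_assoc] at h2
  have := le_of_mul_le_mul_left h2 hC
  linarith

/-! ### The exponential rate at the saddle -/

/-- The properties of `r_*` on which the asymptotics depend. -/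
structure IsSaddle (θ κ : ℕ → ℝ) (r : ℝ) : Prop where
  pos : 0 < r
  summable_theta : ∀ s : ℝ, 0 < s → s < r → Summable fun j : ℕ => θ j / j * s ^ j
  sum_le_one : ∀ M : ℕ, ∑ j ∈ Finset.Icc 1 M, κ j * r ^ j ≤ 1
  one_le_sum : ∀ ρ : ℝ, r < ρ → ∃ M : ℕ, 1 ≤ ∑ j ∈ Finset.Icc 1 M, κ j * ρ ^ j

theorem sum_mono_index {f : ℕ → ℝ} (hf : ∀ j, 1 ≤ j → 0 ≤ f j) {M M' : ℕ} (h : M ≤ M') :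
    ∑ j ∈ Finset.Icc 1 M, f j ≤ ∑ j ∈ Finset.Icc 1 M', f j :=
  Finset.sum_le_sum_of_subset_of_nonneg (Finset.Icc_subset_Icc_right h)
    fun j hj _ => hf j (Finset.mem_Icc.1 hj).1

theorem IsSaddle.eventually_exp_le {θ κ : ℕ → ℝ} {r : ℝ} (hr : IsSaddle θ κ r)
    (hθ : ∀ j : ℕ, 1 ≤ j → 0 ≤ θ j) (hκ : ∀ j : ℕ, 1 ≤ j → 0 ≤ κ j) {n₀ : ℕ}
    (hn₀ : ∀ m ≥ n₀, m ∈ AddSubmonoid.closure {j : ℕ | 1 ≤ j ∧ κ j ≠ 0})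
    (M : ℕ) {ε : ℝ} (hε : 0 < ε) :
    ∀ᶠ N : ℕ in atTop,
      Real.exp (N * ((∑ j ∈ Finset.Icc 1 M, κ j / j * r ^ j) - Real.log r - ε)) ≤
        partitionSum (cycleWeight θ κ N) N := by
  -- The truncated sum is at most 1 at r and at least 1 at ρ, so a root u lies between them; this ρ
  -- makes log u exceed log r by at most ε/2.
  set ρ := r * Real.exp (ε / 2) with hρ
  have hrρ : r < ρ := by
    have : 1 < Real.exp (ε / 2) := Real.one_lt_exp_iff.2 (by linarith)
    have := hr.pos
    nlinarith
  obtain ⟨M₁, hM₁⟩ := hr.one_le_sum ρ hrρ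
  set M₂ := max M M₁ with hM₂
  have hρ0 : 0 < ρ := hr.pos.trans hrρ
  have hone : 1 ≤ ∑ j ∈ Finset.Icc 1 M₂, κ j * ρ ^ j :=
    hM₁.trans (sum_mono_index (fun j hj => mul_nonneg (hκ j hj) (pow_pos hρ0 j).le)
      (le_max_right _ _))
  obtain ⟨u, ⟨hru, huρ⟩, hu⟩ : (1 : ℝ) ∈ (fun v : ℝ => ∑ j ∈ Finset.Icc 1 M₂, κ j * v ^ j) ''
      Set.Icc r ρ :=
    intermediate_value_Icc hrρ.le (by fun_prop) ⟨hr.sum_le_one M₂, hone⟩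
  have hu0 : 0 < u := hr.pos.trans_le hru
  filter_upwards [eventually_exp_le_partitionSum hθ hκ hn₀ hu0 hu (half_pos hε)] with N hN
  refine le_trans (Real.exp_le_exp.2 (mul_le_mul_of_nonneg_left ?_ (Nat.cast_nonneg N))) hN
  have h1 : ∑ j ∈ Finset.Icc 1 M, κ j / j * r ^ j ≤ ∑ j ∈ Finset.Icc 1 M₂, κ j / j * u ^ j := by
    refine (sum_mono_index (f := fun j => κ j / j * r ^ j) (fun j hj => ?_)
      (le_max_left M M₁)).trans (Finset.sum_le_sum fun j hj => ?_)
    · have := hκ j hj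
      have := hr.pos
      positivity
    · have := hκ j (Finset.mem_Icc.1 hj).1
      have := hr.pos
      gcongr
  have h2 : Real.log u ≤ Real.log r + ε / 2 := by
    calc Real.log u ≤ Real.log ρ := Real.log_le_log hu0 huρ
      _ = Real.log r + ε / 2 := by
        rw [hρ, Real.log_mul hr.pos.ne' (Real.exp_pos _).ne', Real.log_exp]
  linarith

/-! ### Tilting and mean cycle counts -/

theorem normConst_eq_partitionSum (θ κ : ℕ → ℝ) (N : ℕ) :
    normConst θ κ N = partitionSum (cycleWeight θ κ N) N :=
  (partitionSum_eq _ N).symm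

theorem weight_nonneg {θ κ : ℕ → ℝ} (hθ : ∀ j : ℕ, 1 ≤ j → 0 ≤ θ j)
    (hκ : ∀ j : ℕ, 1 ≤ j → 0 ≤ κ j) {N : ℕ} (σ : Equiv.Perm (Fin N)) : 0 ≤ weight θ κ N σ :=
  Finset.prod_nonneg fun j hj =>
    pow_nonneg (cycleWeight_nonneg hθ hκ N j (Finset.mem_Icc.1 hj).1) _

/-- The cycle weights with the weight of cycles of length `j` multiplied by `e^t`. -/
noncomputable def tiltedWeight (θ κ : ℕ → ℝ) (N j : ℕ) (t : ℝ) : ℕ → ℝ :=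
  Function.update (cycleWeight θ κ N) j (Real.exp t * cycleWeight θ κ N j)

theorem tiltedWeight_nonneg {θ κ : ℕ → ℝ} (hθ : ∀ j : ℕ, 1 ≤ j → 0 ≤ θ j)
    (hκ : ∀ j : ℕ, 1 ≤ j → 0 ≤ κ j) (N : ℕ) {j : ℕ} (hj : 1 ≤ j) (t : ℝ) :
    ∀ i, 1 ≤ i → 0 ≤ tiltedWeight θ κ N j t i := by
  intro i hi
  unfold tiltedWeight
  by_cases h : i = j
  · subst h
    rw [Function.update_self]
    exact mul_nonneg (Real.exp_pos t).le (cycleWeight_nonneg hθ hκ N i hi)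
  · rw [Function.update_of_ne h]
    exact cycleWeight_nonneg hθ hκ N i hi

theorem partitionSum_tiltedWeight (θ κ : ℕ → ℝ) {N j : ℕ} (hj : 1 ≤ j) (hjN : j ≤ N) (t : ℝ) :
    partitionSum (tiltedWeight θ κ N j t) N = (1 / (N.factorial : ℝ)) *
      ∑ σ : Equiv.Perm (Fin N), weight θ κ N σ * Real.exp (t * cycleCount σ j) := by
  rw [partitionSum_eq]
  congr 1
  refine Finset.sum_congr rfl fun σ _ => ?_
  have hm : j ∈ Finset.Icc 1 N := Finset.mem_Icc.2 ⟨hj, hjN⟩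
  rw [weight, ← Finset.mul_prod_erase _ _ hm, ← Finset.mul_prod_erase _ _ hm]
  rw [Finset.prod_congr rfl (g := fun i => (θ i + N * κ i) ^ cycleCount σ i) fun i hi => by
    rw [tiltedWeight, Function.update_of_ne (Finset.mem_erase.1 hi).1, cycleWeight]]
  rw [tiltedWeight, Function.update_self, mul_pow, ← Real.exp_nat_mul, cycleWeight,
    mul_comm (cycleCount σ j : ℝ) t]
  ring

theorem expect_mul_normConst (θ κ : ℕ → ℝ) {N : ℕ} (hN : normConst θ κ N ≠ 0)
    (X : Equiv.Perm (Fin N) → ℝ) :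
    expect θ κ N X * normConst θ κ N =
      (1 / (N.factorial : ℝ)) * ∑ σ : Equiv.Perm (Fin N), weight θ κ N σ * X σ := by
  rw [expect, Finset.sum_mul, Finset.mul_sum]
  refine Finset.sum_congr rfl fun σ _ => ?_
  have : (N.factorial : ℝ) ≠ 0 := by positivity
  rw [prob]
  field_simp

/-- Jensen's inequality for the exponential, proved with the tangent line at the mean, whose linear
term averages to zero. -/
theorem exp_mul_normConst_le {θ κ : ℕ → ℝ} (hθ : ∀ j : ℕ, 1 ≤ j → 0 ≤ θ j)
    (hκ : ∀ j : ℕ, 1 ≤ j → 0 ≤ κ j) {N j : ℕ} (hj : 1 ≤ j) (hjN : j ≤ N) (t : ℝ)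
    (hN : normConst θ κ N ≠ 0) :
    Real.exp (t * expect θ κ N (fun σ => (cycleCount σ j : ℝ))) * normConst θ κ N ≤
      partitionSum (tiltedWeight θ κ N j t) N := by
  set m := expect θ κ N (fun σ => (cycleCount σ j : ℝ)) with hm
  have hmean := expect_mul_normConst θ κ hN (fun σ => (cycleCount σ j : ℝ))
  rw [← hm] at hmean
  rw [partitionSum_tiltedWeight θ κ hj hjN t]
  have hlow : ∀ σ : Equiv.Perm (Fin N),
      weight θ κ N σ * (Real.exp (t * m) * (1 + t * cycleCount σ j - t * m)) ≤
        weight θ κ N σ * Real.exp (t * cycleCount σ j) := by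
    intro σ
    refine mul_le_mul_of_nonneg_left ?_ (weight_nonneg hθ hκ σ)
    have h1 := Real.add_one_le_exp (t * cycleCount σ j - t * m)
    calc Real.exp (t * m) * (1 + t * cycleCount σ j - t * m)
        ≤ Real.exp (t * m) * Real.exp (t * cycleCount σ j - t * m) := by
          refine mul_le_mul_of_nonneg_left (by linarith) (Real.exp_pos _).le
      _ = _ := by
          rw [← Real.exp_add]
          congr 1
          ring
  have hsum : (1 / (N.factorial : ℝ)) * ∑ σ : Equiv.Perm (Fin N),
      weight θ κ N σ * (Real.exp (t * m) * (1 + t * cycleCount σ j - t * m)) =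
      Real.exp (t * m) * normConst θ κ N := by
    have h1 : ∑ σ : Equiv.Perm (Fin N),
        weight θ κ N σ * (Real.exp (t * m) * (1 + t * cycleCount σ j - t * m)) =
        Real.exp (t * m) * ((1 - t * m) * ∑ σ : Equiv.Perm (Fin N), weight θ κ N σ +
          t * ∑ σ : Equiv.Perm (Fin N), weight θ κ N σ * cycleCount σ j) := by
      rw [Finset.mul_sum, Finset.mul_sum, ← Finset.sum_add_distrib, Finset.mul_sum]
      exact Finset.sum_congr rfl fun σ _ => by ring
    rw [h1]
    have h2 : normConst θ κ N =
      (1 / (N.factorial : ℝ)) * ∑ σ : Equiv.Perm (Fin N), weight θ κ N σ := rfl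
    calc (1 / (N.factorial : ℝ)) * (Real.exp (t * m) *
          ((1 - t * m) * ∑ σ : Equiv.Perm (Fin N), weight θ κ N σ +
          t * ∑ σ : Equiv.Perm (Fin N), weight θ κ N σ * cycleCount σ j))
        = Real.exp (t * m) * ((1 - t * m) *
            ((1 / (N.factorial : ℝ)) * ∑ σ : Equiv.Perm (Fin N), weight θ κ N σ) +
          t * ((1 / (N.factorial : ℝ)) *
            ∑ σ : Equiv.Perm (Fin N), weight θ κ N σ * cycleCount σ j)) := by ring
      _ = _ := by
        rw [← hmean, ← h2]
        ring
  rw [← hsum]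
  exact mul_le_mul_of_nonneg_left (Finset.sum_le_sum fun σ _ => hlow σ) (by positivity)

theorem tiltedWeight_partitionSum_le {θ κ : ℕ → ℝ} (hθ : ∀ j : ℕ, 1 ≤ j → 0 ≤ θ j)
    (hκ : ∀ j : ℕ, 1 ≤ j → 0 ≤ κ j) {N j : ℕ} (hj : 1 ≤ j) (hjN : j ≤ N) (t : ℝ)
    {s : ℝ} (hs : 0 < s) {G A : ℝ} (hG : ∑ i ∈ Finset.Icc 1 N, θ i / i * s ^ i ≤ G)
    (hA : ∑ i ∈ Finset.Icc 1 N, κ i / i * s ^ i ≤ A) :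
    partitionSum (tiltedWeight θ κ N j t) N ≤
      Real.exp (N * (A - Real.log s) + G +
        (Real.exp t - 1) * (cycleWeight θ κ N j / j * s ^ j)) := by
  have h1 := partitionSum_mul_pow_le (tiltedWeight_nonneg hθ hκ N hj t) hs.le N
  have hm : j ∈ Finset.Icc 1 N := Finset.mem_Icc.2 ⟨hj, hjN⟩
  have h2 : ∑ i ∈ Finset.Icc 1 N, tiltedWeight θ κ N j t i / i * s ^ i =
      ∑ i ∈ Finset.Icc 1 N, cycleWeight θ κ N i / i * s ^ i +
        (Real.exp t - 1) * (cycleWeight θ κ N j / j * s ^ j) := by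
    rw [← Finset.add_sum_erase _ _ hm, ← Finset.add_sum_erase _ _ hm]
    rw [Finset.sum_congr rfl (g := fun i => cycleWeight θ κ N i / i * s ^ i) fun i hi => by
      rw [tiltedWeight, Function.update_of_ne (Finset.mem_erase.1 hi).1]]
    rw [tiltedWeight, Function.update_self]
    ring
  have h3 : ∑ i ∈ Finset.Icc 1 N, cycleWeight θ κ N i / i * s ^ i =
      ∑ i ∈ Finset.Icc 1 N, θ i / i * s ^ i + N * ∑ i ∈ Finset.Icc 1 N, κ i / i * s ^ i := by
    rw [Finset.mul_sum, ← Finset.sum_add_distrib]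
    refine Finset.sum_congr rfl fun i _ => ?_
    rw [cycleWeight]
    ring
  have h4 : (N : ℝ) * ∑ i ∈ Finset.Icc 1 N, κ i / i * s ^ i ≤ N * A := by gcongr
  have h5 : partitionSum (tiltedWeight θ κ N j t) N * s ^ N ≤
      Real.exp (N * (A - Real.log s) + G +
        (Real.exp t - 1) * (cycleWeight θ κ N j / j * s ^ j)) * s ^ N := by
    refine h1.trans ?_
    rw [← Real.exp_log (pow_pos hs N), Real.log_pow, ← Real.exp_add]
    refine Real.exp_le_exp.2 ?_
    rw [h2, h3]
    linarith
  exact le_of_mul_le_mul_right h5 (pow_pos hs N)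

theorem exists_forall_le_forall_sub_lt {F : ℕ → ℝ} {b : ℝ} (hb : ∀ M, F M ≤ b) :
    ∃ A : ℝ, (∀ M, F M ≤ A) ∧ ∀ ε > 0, ∃ M, A - ε < F M := by
  have hbdd : BddAbove (Set.range F) := ⟨b, by rintro _ ⟨M, rfl⟩; exact hb M⟩
  exact ⟨⨆ M, F M, fun M => le_ciSup hbdd M, fun ε hε => exists_lt_of_lt_ciSup (by linarith)⟩

theorem IsSaddle.eventually_normConst_pos {θ κ : ℕ → ℝ} {r : ℝ} (hr : IsSaddle θ κ r)
    (hθ : ∀ j : ℕ, 1 ≤ j → 0 ≤ θ j) (hκ : ∀ j : ℕ, 1 ≤ j → 0 ≤ κ j) {n₀ : ℕ}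
    (hn₀ : ∀ m ≥ n₀, m ∈ AddSubmonoid.closure {j : ℕ | 1 ≤ j ∧ κ j ≠ 0}) :
    ∀ᶠ N : ℕ in atTop, 0 < normConst θ κ N := by
  filter_upwards [hr.eventually_exp_le hθ hκ hn₀ 0 one_pos] with N hN
  rw [normConst_eq_partitionSum]
  exact (Real.exp_pos _).trans_le hN

/-- Comparing the tilted upper bound with the untilted lower bound cancels the common rate A - log
r. The error ε is spent in quarters: on the lower bound, on truncating at M, on moving from r to s,
and on the bounded θ terms divided by N. -/
theorem IsSaddle.eventually_mul_expect_le {θ κ : ℕ → ℝ} {r : ℝ} (hr : IsSaddle θ κ r)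
    (hθ : ∀ j : ℕ, 1 ≤ j → 0 ≤ θ j) (hκ : ∀ j : ℕ, 1 ≤ j → 0 ≤ κ j) {n₀ : ℕ}
    (hn₀ : ∀ m ≥ n₀, m ∈ AddSubmonoid.closure {j : ℕ | 1 ≤ j ∧ κ j ≠ 0})
    {j : ℕ} (hj : 1 ≤ j) (t : ℝ) {ε : ℝ} (hε : 0 < ε) :
    ∀ᶠ N : ℕ in atTop, t * (expect θ κ N (fun σ => (cycleCount σ j : ℝ)) / N) ≤
      (Real.exp t - 1) * (κ j / j * r ^ j) + ε := by
  have hr0 := hr.pos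
  obtain ⟨A, hA, hAε⟩ := exists_forall_le_forall_sub_lt
    (F := fun M => ∑ i ∈ Finset.Icc 1 M, κ i / i * r ^ i) (b := 1) fun M => by
      refine (Finset.sum_le_sum fun i hi => ?_).trans (hr.sum_le_one M)
      have h1 : (1 : ℝ) ≤ i := by exact_mod_cast (Finset.mem_Icc.1 hi).1
      have h2 := hκ i (Finset.mem_Icc.1 hi).1
      gcongr
      exact div_le_self h2 h1
  obtain ⟨M, hM⟩ := hAε (ε / 4) (by linarith)
  have hlow := hr.eventually_exp_le hθ hκ hn₀ M (ε := ε / 4) (by linarith)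
  have hcont : ContinuousAt (fun s : ℝ => Real.log r - Real.log s +
      (Real.exp t - 1) * (κ j / j * s ^ j)) r := by
    have := Real.continuousAt_log hr0.ne'
    fun_prop
  -- The upper bound is taken at s strictly below r because g_θ may diverge at r.
  have hev : ∀ᶠ s in 𝓝[<] r, Real.log r - Real.log s + (Real.exp t - 1) * (κ j / j * s ^ j) <
      (Real.exp t - 1) * (κ j / j * r ^ j) + ε / 4 := by
    refine (hcont.tendsto.mono_left nhdsWithin_le_nhds).eventually_lt_const ?_
    linarith
  obtain ⟨s, hs, hs0, hsr⟩ : ∃ s, Real.log r - Real.log s +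
      (Real.exp t - 1) * (κ j / j * s ^ j) < (Real.exp t - 1) * (κ j / j * r ^ j) + ε / 4 ∧
      0 < s ∧ s < r := by
    obtain ⟨s, h1, h2⟩ := (hev.and (Ioo_mem_nhdsLT hr0)).exists
    exact ⟨s, h1, h2⟩
  set G := ∑' i : ℕ, θ i / i * s ^ i with hG
  have hGle : ∀ N : ℕ, ∑ i ∈ Finset.Icc 1 N, θ i / i * s ^ i ≤ G := fun N => by
    refine (hr.summable_theta s hs0 hsr).sum_le_tsum _ fun i hi => ?_
    rcases Nat.eq_zero_or_pos i with rfl | h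
    · simp
    · have := hθ i h
      positivity
  have hAle : ∀ N : ℕ, ∑ i ∈ Finset.Icc 1 N, κ i / i * s ^ i ≤ A := fun N => by
    refine (Finset.sum_le_sum fun i hi => ?_).trans (hA N)
    have := hκ i (Finset.mem_Icc.1 hi).1
    gcongr
  have hzero : Tendsto (fun N : ℕ => (G + (Real.exp t - 1) * (θ j / j * s ^ j)) / (N : ℝ))
      atTop (𝓝 0) := tendsto_const_div_atTop_nhds_zero_nat _
  filter_upwards [hlow, hzero.eventually_lt_const (show (0 : ℝ) < ε / 4 by linarith),
    eventually_ge_atTop j, hr.eventually_normConst_pos hθ hκ hn₀] with N hN hN0 hjN hpos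
  have hNpos : (0 : ℝ) < N := by exact_mod_cast hj.trans hjN
  set m := expect θ κ N (fun σ => (cycleCount σ j : ℝ)) with hm
  have h1 := exp_mul_normConst_le hθ hκ hj hjN t hpos.ne'
  have h2 := tiltedWeight_partitionSum_le hθ hκ hj hjN t hs0 (hGle N) (hAle N)
  rw [← normConst_eq_partitionSum] at hN
  have h3 := (mul_le_mul_of_nonneg_left hN (Real.exp_pos (t * m)).le).trans (h1.trans h2)
  rw [← Real.exp_add, Real.exp_le_exp, cycleWeight] at h3
  have h4 : (t * m) / N ≤ (N * (Real.log r - Real.log s + (Real.exp t - 1) * (κ j / j * s ^ j)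
      + ε / 2) + (G + (Real.exp t - 1) * (θ j / j * s ^ j))) / N := by
    gcongr
    have h5 : (N : ℝ) * (A - ε / 4) ≤ N * ∑ i ∈ Finset.Icc 1 M, κ i / i * r ^ i := by gcongr
    have h6 : (Real.exp t - 1) * ((θ j + N * κ j) / j * s ^ j) =
      (Real.exp t - 1) * (θ j / j * s ^ j) + N * ((Real.exp t - 1) * (κ j / j * s ^ j)) := by ring
    rw [h6] at h3
    linarith
  rw [add_div, mul_div_cancel_left₀ _ hNpos.ne'] at h4
  rw [← mul_div_assoc]
  linarith

/-- Dividing by t > 0 bounds a from above and dividing by t < 0 bounds it from below; both bounds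
tend to b as t → 0. -/
theorem tendsto_of_exp_bound {a : ℕ → ℝ} {b : ℝ} (hb : 0 ≤ b)
    (h : ∀ t ε : ℝ, 0 < ε → ∀ᶠ N in atTop, t * a N ≤ (Real.exp t - 1) * b + ε) :
    Tendsto a atTop (𝓝 b) := by
  rw [Metric.tendsto_atTop']
  intro δ hδ
  -- With ε = t² and e^v - 1 ≤ v + v² for |v| ≤ 1, both choices ±t give an error of at most t(b + 1)
  -- < δ.
  set t := min 1 (δ / (2 * (b + 1))) with ht
  have ht0 : 0 < t := lt_min one_pos (by positivity)
  have ht1 : t ≤ 1 := min_le_left _ _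
  have htδ : t * (b + 1) < δ := by
    have : t * (b + 1) ≤ δ / (2 * (b + 1)) * (b + 1) := by
      gcongr
      exact min_le_right _ _
    have h2 : δ / (2 * (b + 1)) * (b + 1) = δ / 2 := by field_simp
    linarith
  have key : ∀ v : ℝ, |v| ≤ 1 → Real.exp v - 1 ≤ v + v ^ 2 := fun v hv => by
    have := (abs_le.1 (Real.abs_exp_sub_one_sub_id_le hv)).2
    linarith
  have h1 := h t (t ^ 2) (by positivity)
  have h2 := h (-t) (t ^ 2) (by positivity)
  obtain ⟨N₀, hN₀⟩ := eventually_atTop.1 (h1.and h2)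
  refine ⟨N₀, fun N hN => ?_⟩
  obtain ⟨h3, h4⟩ := hN₀ N hN.le
  have k1 := mul_le_mul_of_nonneg_right (key t (by rw [abs_of_pos ht0]; exact ht1)) hb
  have k2 := mul_le_mul_of_nonneg_right (key (-t) (by rw [abs_neg, abs_of_pos ht0]; exact ht1)) hb
  have h5 : t * (a N - b) ≤ t * (t * (b + 1)) := by nlinarith
  have h6 : t * (b - a N) ≤ t * (t * (b + 1)) := by nlinarith
  have h7 := le_of_mul_le_mul_left h5 ht0
  have h8 := le_of_mul_le_mul_left h6 ht0
  rw [Real.dist_eq, abs_lt]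
  constructor <;> linarith

theorem IsSaddle.tendsto_expect {θ κ : ℕ → ℝ} {r : ℝ} (hr : IsSaddle θ κ r)
    (hθ : ∀ j : ℕ, 1 ≤ j → 0 ≤ θ j) (hκ : ∀ j : ℕ, 1 ≤ j → 0 ≤ κ j) {n₀ : ℕ}
    (hn₀ : ∀ m ≥ n₀, m ∈ AddSubmonoid.closure {j : ℕ | 1 ≤ j ∧ κ j ≠ 0})
    {j : ℕ} (hj : 1 ≤ j) :
    Tendsto (fun N : ℕ => expect θ κ N (fun σ => (cycleCount σ j : ℝ)) / N) atTop
      (𝓝 (κ j / j * r ^ j)) := by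
  refine tendsto_of_exp_bound ?_ fun t ε hε => hr.eventually_mul_expect_le hθ hκ hn₀ hj t hε
  have := hκ j hj
  have := hr.pos
  positivity

/-! ### From cycle counts to the fraction in long cycles -/

theorem longFraction_eq (θ κ : ℕ → ℝ) {K N : ℕ} (hKN : K ≤ N) (hN : 1 ≤ N)
    (hpos : 0 < normConst θ κ N) :
    longFraction θ κ K N = 1 - ∑ j ∈ Finset.Icc 1 K,
      (j : ℝ) * (expect θ κ N (fun σ => (cycleCount σ j : ℝ)) / N) := by
  have hN0 : (N : ℝ) ≠ 0 := by positivity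
  have hsplit : ∀ σ : Equiv.Perm (Fin N),
      ∑ j ∈ Finset.Ioc K N, (j : ℝ) * (cycleCount σ j : ℝ) =
        N - ∑ j ∈ Finset.Icc 1 K, (j : ℝ) * (cycleCount σ j : ℝ) := by
    intro σ
    have h1 : ∑ j ∈ Finset.Icc 1 N, (j : ℝ) * (cycleCount σ j : ℝ) = N := by
      exact_mod_cast sum_mul_cycleCount σ
    have h2 : Finset.Icc 1 N = Finset.Icc 1 K ∪ Finset.Ioc K N := by
      ext j
      simp only [Finset.mem_union, Finset.mem_Icc, Finset.mem_Ioc]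
      omega
    have h3 : Disjoint (Finset.Icc 1 K) (Finset.Ioc K N) := by
      rw [Finset.disjoint_left]
      intro j h4 h5
      rw [Finset.mem_Icc] at h4
      rw [Finset.mem_Ioc] at h5
      omega
    rw [h2, Finset.sum_union h3] at h1
    linarith
  have hprob : ∑ σ : Equiv.Perm (Fin N), prob θ κ N σ = 1 := by
    have h1 := expect_mul_normConst θ κ hpos.ne' (fun _ => (1 : ℝ))
    simp only [mul_one, expect] at h1
    change _ = normConst θ κ N at h1
    exact mul_right_cancel₀ hpos.ne' (h1.trans (one_mul _).symm)
  have hexp : expect θ κ N (fun σ => ∑ j ∈ Finset.Ioc K N, (j : ℝ) * (cycleCount σ j : ℝ)) =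
      N - ∑ j ∈ Finset.Icc 1 K, (j : ℝ) * expect θ κ N (fun σ => (cycleCount σ j : ℝ)) := by
    simp only [expect, hsplit, mul_sub, Finset.sum_sub_distrib, Finset.mul_sum]
    rw [← Finset.sum_mul, hprob, one_mul, Finset.sum_comm]
    congr 1
    exact Finset.sum_congr rfl fun j _ => Finset.sum_congr rfl fun σ _ => by ring
  rw [longFraction, hexp, mul_sub, Finset.mul_sum]
  congr 1
  · field_simp
  · exact Finset.sum_congr rfl fun j _ => by ring

theorem IsSaddle.tendsto_longFraction {θ κ : ℕ → ℝ} {r : ℝ} (hr : IsSaddle θ κ r)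
    (hθ : ∀ j : ℕ, 1 ≤ j → 0 ≤ θ j) (hκ : ∀ j : ℕ, 1 ≤ j → 0 ≤ κ j) {n₀ : ℕ}
    (hn₀ : ∀ m ≥ n₀, m ∈ AddSubmonoid.closure {j : ℕ | 1 ≤ j ∧ κ j ≠ 0}) (K : ℕ) :
    Tendsto (fun N : ℕ => longFraction θ κ K N) atTop
      (𝓝 (1 - ∑ j ∈ Finset.Icc 1 K, κ j * r ^ j)) := by
  have h1 : Tendsto (fun N : ℕ => 1 - ∑ j ∈ Finset.Icc 1 K,
      (j : ℝ) * (expect θ κ N (fun σ => (cycleCount σ j : ℝ)) / N)) atTop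
      (𝓝 (1 - ∑ j ∈ Finset.Icc 1 K, (j : ℝ) * (κ j / j * r ^ j))) := by
    refine tendsto_const_nhds.sub (tendsto_finsetSum _ fun j hj => ?_)
    exact (hr.tendsto_expect hθ hκ hn₀ (Finset.mem_Icc.1 hj).1).const_mul _
  have h2 : ∑ j ∈ Finset.Icc 1 K, (j : ℝ) * (κ j / j * r ^ j) =
      ∑ j ∈ Finset.Icc 1 K, κ j * r ^ j := by
    refine Finset.sum_congr rfl fun j hj => ?_
    have : (j : ℝ) ≠ 0 := by
      have := (Finset.mem_Icc.1 hj).1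
      positivity
    field_simp
  rw [← h2]
  refine h1.congr' ?_
  filter_upwards [eventually_ge_atTop K, eventually_ge_atTop 1,
    hr.eventually_normConst_pos hθ hκ hn₀] with N h3 h4 h5
  exact (longFraction_eq θ κ h3 h4 h5).symm

/-! ### The series g_κ^{1} and the existence of r_* -/

theorem gMod_one_coeff (κ : ℕ → ℝ) {j : ℕ} (hj : 1 ≤ j) :
    (j.descFactorial 1 : ℝ) * (κ j / (j : ℝ)) = κ j := by
  have : (j : ℝ) ≠ 0 := by positivity
  rw [Nat.descFactorial_one]
  field_simp

theorem sum_range_gMod_one (κ : ℕ → ℝ) (r : ℝ) (M : ℕ) :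
    ∑ j ∈ Finset.range (M + 1), (j.descFactorial 1 : ℝ) * (κ j / (j : ℝ)) * r ^ j =
      ∑ j ∈ Finset.Icc 1 M, κ j * r ^ j := by
  induction M with
  | zero => simp
  | succ M ih =>
    rw [Finset.sum_range_succ, ih, Finset.sum_Icc_succ_top (by omega),
      gMod_one_coeff κ (by omega)]

theorem gMod_one_coeff_nonneg {κ : ℕ → ℝ} (hκ : ∀ j : ℕ, 1 ≤ j → 0 ≤ κ j) (j : ℕ) :
    0 ≤ (j.descFactorial 1 : ℝ) * (κ j / (j : ℝ)) := by
  rcases Nat.eq_zero_or_pos j with rfl | hj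
  · simp
  · rw [gMod_one_coeff κ hj]
    exact hκ j hj

theorem gMod_one_ofReal {κ : ℕ → ℝ} (hκ : ∀ j : ℕ, 1 ≤ j → 0 ≤ κ j) {r : ℝ} (hr : 0 ≤ r) :
    gMod κ 1 (ENNReal.ofReal r) =
      ∑' j : ℕ, ENNReal.ofReal ((j.descFactorial 1 : ℝ) * (κ j / (j : ℝ)) * r ^ j) := by
  rw [gMod]
  refine tsum_congr fun j => ?_
  rw [ENNReal.ofReal_mul (gMod_one_coeff_nonneg hκ j), ENNReal.ofReal_pow hr]

theorem gMod_one_le_one_iff {κ : ℕ → ℝ} (hκ : ∀ j : ℕ, 1 ≤ j → 0 ≤ κ j) {r : ℝ} (hr : 0 ≤ r) :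
    gMod κ 1 (ENNReal.ofReal r) ≤ 1 ↔ ∀ M : ℕ, ∑ j ∈ Finset.Icc 1 M, κ j * r ^ j ≤ 1 := by
  have hnn : ∀ j : ℕ, 0 ≤ (j.descFactorial 1 : ℝ) * (κ j / (j : ℝ)) * r ^ j := fun j =>
    mul_nonneg (gMod_one_coeff_nonneg hκ j) (pow_nonneg hr j)
  rw [gMod_one_ofReal hκ hr, ENNReal.tsum_eq_iSup_nat' (tendsto_add_atTop_nat 1), iSup_le_iff]
  refine forall_congr' fun M => ?_
  rw [← ENNReal.ofReal_sum_of_nonneg fun j _ => hnn j, sum_range_gMod_one, ENNReal.ofReal_le_one]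

theorem gMod_one_strictMono {κ : ℕ → ℝ} (hpos : ∃ j : ℕ, 2 ≤ j ∧ 0 < κ j) {a b : ℝ}
    (ha : 0 ≤ a) (hab : a < b) (hfin : gMod κ 1 (ENNReal.ofReal a) ≠ ∞) :
    gMod κ 1 (ENNReal.ofReal a) < gMod κ 1 (ENNReal.ofReal b) := by
  obtain ⟨j, hj, hκj⟩ := hpos
  refine ENNReal.tsum_lt_tsum (i := j) hfin (fun i => ?_) ?_
  · gcongr
  · rw [gMod_one_coeff κ (by omega)]
    refine (ENNReal.mul_lt_mul_iff_right (by simpa using hκj) ENNReal.ofReal_ne_top).2 ?_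
    exact ENNReal.pow_lt_pow_left (by omega)
      ((ENNReal.ofReal_lt_ofReal_iff (ha.trans_lt hab)).2 hab)

theorem summable_of_lt_convRadius {a : ℕ → ℝ} {s : ℝ} (hs : 0 ≤ s)
    (h : ENNReal.ofReal s < convRadius a) : Summable fun j : ℕ => a j / j * s ^ j := by
  have h1 := (FormalMultilinearSeries.ofScalars ℂ
    (fun j : ℕ => ((a j / (j : ℝ) : ℝ) : ℂ))).summable_norm_mul_pow (r := s.toNNReal) h
  refine Summable.of_norm (h1.congr fun j => ?_)
  rw [FormalMultilinearSeries.ofScalars_norm, Complex.norm_real, norm_mul, norm_pow,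
    Real.coe_toNNReal s hs, Real.norm_of_nonneg hs]

/-- For ρ strictly between s and the radius, the terms are dominated by C j (s/ρ)^j. -/
theorem summable_gMod_one {κ : ℕ → ℝ} (hκ : ∀ j : ℕ, 1 ≤ j → 0 ≤ κ j) {s : ℝ} (hs : 0 ≤ s)
    (h : ENNReal.ofReal s < convRadius κ) :
    Summable fun j : ℕ => (j.descFactorial 1 : ℝ) * (κ j / (j : ℝ)) * s ^ j := by
  obtain ⟨ρ, hsρ, hρ⟩ := ENNReal.lt_iff_exists_nnreal_btwn.1 h
  have hsρ' : s < ρ := by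
    rw [← ENNReal.ofReal_coe_nnreal] at hsρ
    exact (ENNReal.ofReal_lt_ofReal_iff_of_nonneg hs).1 hsρ
  have hρ0 : (0 : ℝ) < ρ := hs.trans_lt hsρ'
  obtain ⟨C, hC, hle⟩ := (FormalMultilinearSeries.ofScalars ℂ
    (fun j : ℕ => ((κ j / (j : ℝ) : ℝ) : ℂ))).norm_mul_pow_le_of_lt_radius hρ
  have hq : ‖s / ρ‖ < 1 := by
    rw [Real.norm_of_nonneg (by positivity), div_lt_one hρ0]
    exact hsρ'
  have hg := (summable_pow_mul_geometric_of_norm_lt_one 1 hq).mul_left C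
  refine Summable.of_nonneg_of_le
    (fun j => mul_nonneg (gMod_one_coeff_nonneg hκ j) (pow_nonneg hs j)) (fun j => ?_) hg
  have h2 := hle j
  rw [FormalMultilinearSeries.ofScalars_norm, Complex.norm_real] at h2
  have h3 : κ j / j * (ρ : ℝ) ^ j ≤ C := by
    refine le_trans ?_ h2
    gcongr
    exact Real.le_norm_self _
  rw [Nat.descFactorial_one, pow_one, div_pow]
  calc (j : ℝ) * (κ j / j) * s ^ j = (κ j / j * (ρ : ℝ) ^ j) * (j * (s ^ j / (ρ : ℝ) ^ j)) := by
        field_simp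
    _ ≤ C * (j * (s ^ j / (ρ : ℝ) ^ j)) := by gcongr

theorem ofReal_le_convRadius {κ : ℕ → ℝ} (hκ : ∀ j : ℕ, 1 ≤ j → 0 ≤ κ j) {ρ : ℝ} (hρ : 0 ≤ ρ)
    {C : ℝ} (hC : 0 ≤ C) (h : ∀ j, 1 ≤ j → κ j * ρ ^ j ≤ C) :
    ENNReal.ofReal ρ ≤ convRadius κ := by
  refine FormalMultilinearSeries.le_radius_of_bound _ C fun j => ?_
  rw [FormalMultilinearSeries.ofScalars_norm, Complex.norm_real, Real.coe_toNNReal ρ hρ]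
  rcases Nat.eq_zero_or_pos j with rfl | hj
  · simpa using hC
  · have h1 : (1 : ℝ) ≤ j := by exact_mod_cast hj
    have h2 := hκ j hj
    rw [Real.norm_of_nonneg (by positivity)]
    refine le_trans ?_ (h j hj)
    gcongr
    exact div_le_self h2 h1

/-- At an infinite argument, one positive coefficient of positive index already makes the series
infinite. -/
theorem convRadius_ne_top {κ : ℕ → ℝ} (hpos : ∃ j : ℕ, 2 ≤ j ∧ 0 < κ j) (h : gModR κ 1 ≤ 1) :
    convRadius κ ≠ ∞ := by
  intro htop
  obtain ⟨j, hj, hκj⟩ := hpos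
  rw [gModR, htop] at h
  have h1 := (ENNReal.le_tsum (f := fun j : ℕ =>
    ENNReal.ofReal ((j.descFactorial 1 : ℝ) * (κ j / (j : ℝ))) * ∞ ^ j) j).trans h
  rw [gMod_one_coeff κ (by omega), ENNReal.top_pow (by omega),
    ENNReal.mul_top (by simpa using hκj)] at h1
  simp at h1

theorem exists_gMod_one_eq_one {κ : ℕ → ℝ} (hκ : ∀ j : ℕ, 1 ≤ j → 0 ≤ κ j)
    (hR : 0 < convRadius κ) (h : 1 < gModR κ 1) :
    ∃ r : ℝ, 0 < r ∧ ENNReal.ofReal r < convRadius κ ∧ gMod κ 1 (ENNReal.ofReal r) = 1 := by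
  rw [gModR, gMod, ENNReal.tsum_eq_iSup_nat, lt_iSup_iff] at h
  obtain ⟨M, hM⟩ := h
  -- A finite partial sum already exceeds 1 at R. As a polynomial on `ℝ≥0∞` it is continuous even at
  -- R = ∞, so it still exceeds 1 at some finite ρ < R, and the intermediate value theorem applies
  -- on [0, ρ].
  have hcont : Continuous fun x : ℝ≥0∞ => ∑ j ∈ Finset.range M,
      ENNReal.ofReal ((j.descFactorial 1 : ℝ) * (κ j / (j : ℝ))) * x ^ j :=
    continuous_finsetSum _ fun j _ =>
      (ENNReal.continuous_const_mul ENNReal.ofReal_ne_top).comp (ENNReal.continuous_pow j)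
  have hne : (𝓝[<] convRadius κ).NeBot := nhdsLT_neBot_of_exists_lt ⟨0, hR⟩
  obtain ⟨x, hx, hxR⟩ := (((hcont.tendsto _).eventually_const_lt hM).filter_mono
    nhdsWithin_le_nhds |>.and self_mem_nhdsWithin).exists (f := 𝓝[<] convRadius κ)
  have hxR' : x < convRadius κ := hxR
  lift x to NNReal using (hxR'.trans_le le_top).ne
  set ρ : ℝ := x.toReal with hρ
  have hxρ : (x : ℝ≥0∞) = ENNReal.ofReal ρ := (ENNReal.ofReal_coe_nnreal).symm
  have hρ0 : 0 ≤ ρ := x.2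
  rw [hxρ] at hx hxR'
  have hone : 1 < gMod κ 1 (ENNReal.ofReal ρ) := hx.trans_le (ENNReal.sum_le_tsum _)
  set f : ℝ → ℝ := fun r => ∑' j : ℕ, (j.descFactorial 1 : ℝ) * (κ j / (j : ℝ)) * r ^ j with hf
  have hsum := summable_gMod_one hκ hρ0 hxR'
  have hle : ∀ r ∈ Set.Icc 0 ρ, ∀ j : ℕ,
      ‖(j.descFactorial 1 : ℝ) * (κ j / (j : ℝ)) * r ^ j‖ ≤
        (j.descFactorial 1 : ℝ) * (κ j / (j : ℝ)) * ρ ^ j := by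
    intro r hr j
    have h1 := gMod_one_coeff_nonneg hκ j
    have h2 := hr.1
    rw [Real.norm_of_nonneg (mul_nonneg h1 (pow_nonneg h2 j))]
    exact mul_le_mul_of_nonneg_left (pow_le_pow_left₀ h2 hr.2 j) h1
  have hfg : ∀ r ∈ Set.Icc 0 ρ, gMod κ 1 (ENNReal.ofReal r) = ENNReal.ofReal (f r) := by
    intro r hr
    rw [gMod_one_ofReal hκ hr.1, hf, ENNReal.ofReal_tsum_of_nonneg
      (fun j => mul_nonneg (gMod_one_coeff_nonneg hκ j) (pow_nonneg hr.1 j))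
      (Summable.of_norm_bounded hsum (hle r hr))]
  have hfc : ContinuousOn f (Set.Icc 0 ρ) :=
    continuousOn_tsum (fun j => by fun_prop) hsum fun j r hr => hle r hr j
  have hf0 : f 0 = 0 := by
    rw [hf]
    refine (tsum_congr fun j => ?_).trans tsum_zero
    rcases Nat.eq_zero_or_pos j with rfl | hj
    · simp
    · rw [zero_pow (by omega), mul_zero]
  have hfρ : 1 ≤ f ρ := by
    rw [hfg ρ ⟨hρ0, le_rfl⟩] at hone
    exact (ENNReal.one_lt_ofReal.1 hone).le
  obtain ⟨r, hr, hfr⟩ := intermediate_value_Icc hρ0 hfc ⟨hf0.trans_le zero_le_one, hfρ⟩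
  refine ⟨r, lt_of_le_of_ne hr.1 ?_, (ENNReal.ofReal_le_ofReal hr.2).trans_lt hxR', ?_⟩
  · rintro rfl
    rw [hf0] at hfr
    exact zero_ne_one hfr
  · rw [hfg r hr, hfr, ENNReal.ofReal_one]

theorem existsUnique_isRStar {κ : ℕ → ℝ} (hκ : ∀ j : ℕ, 1 ≤ j → 0 ≤ κ j)
    (hpos : ∃ j : ℕ, 2 ≤ j ∧ 0 < κ j) (hR : 0 < convRadius κ) : ∃! r : ℝ, IsRStar κ r := by
  rcases le_or_gt (gModR κ 1) 1 with h | h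
  · have htop := convRadius_ne_top hpos h
    have heq : ENNReal.ofReal (convRadius κ).toReal = convRadius κ := ENNReal.ofReal_toReal htop
    refine ⟨(convRadius κ).toReal, ⟨ENNReal.toReal_pos hR.ne' htop, heq.le, fun h1 => ?_,
      fun _ => heq⟩, fun r hr => ?_⟩
    · rw [heq]
      exact le_antisymm h h1
    · rw [← hr.of_le_one h, ENNReal.toReal_ofReal hr.pos.le]
  · obtain ⟨r, hr0, hrR, hr1⟩ := exists_gMod_one_eq_one hκ hR h
    refine ⟨r, ⟨hr0, hrR.le, fun _ => hr1, fun h1 => absurd h1 (not_le.2 h)⟩, fun r' hr' => ?_⟩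
    have hr1' := hr'.of_one_le h.le
    by_contra hne
    rcases lt_or_gt_of_ne hne with hlt | hlt
    · have := gMod_one_strictMono hpos hr'.pos.le hlt (by rw [hr1']; exact ENNReal.one_ne_top)
      rw [hr1, hr1'] at this
      exact lt_irrefl _ this
    · have := gMod_one_strictMono hpos hr0.le hlt (by rw [hr1]; exact ENNReal.one_ne_top)
      rw [hr1, hr1'] at this
      exact lt_irrefl _ this

/-! ### The hypotheses supply a saddle -/

theorem IsContinuation.summable {a : ℕ → ℝ} {R : ℝ} {D : Set ℂ} {G : ℂ → ℂ}
    (h : IsContinuation a R D G) {s : ℝ} (hs : 0 ≤ s) (hsR : s < R) :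
    Summable fun j : ℕ => a j / j * s ^ j := by
  have h1 := (h.hasSum (s : ℂ) (by rwa [Complex.norm_real, Real.norm_of_nonneg hs])).summable
  rw [← Complex.summable_ofReal]
  refine h1.congr fun j => ?_
  push_cast
  rfl

theorem AnalyticHyp.summable_theta {θ κ : ℕ → ℝ} (hyp : AnalyticHyp θ κ) {r : ℝ}
    (hr : IsRStar κ r) {s : ℝ} (hs : 0 < s) (hsr : s < r) :
    Summable fun j : ℕ => θ j / j * s ^ j := by
  have hsR : ENNReal.ofReal s < convRadius κ :=
    ((ENNReal.ofReal_lt_ofReal_iff hr.pos).2 hsr).trans_le hr.le_radius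
  -- In the critical and supercritical cases r is R itself, so convergence of the extended series on
  -- |z| < R covers every s < r.
  have hR : gModR κ 1 ≤ 1 → s < (convRadius κ).toReal := fun h => by
    rw [← hr.of_le_one h, ENNReal.toReal_ofReal hr.pos.le]
    exact hsr
  rcases hyp with h | h | h | h | h | h
  · exact summable_of_lt_convRadius hs.le (hsR.trans_le h.1)
  · obtain ⟨h1, η, φ, θs, δ, Gθ, Gκ, -, -, -, -, -, h2, -⟩ := h
    exact h2.summable hs.le (hR h1.le)
  · obtain ⟨h1, η, φ, s', as, δ, Gθ, Gκ, -, -, -, -, -, -, -, -, -, h2, -⟩ := h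
    exact h2.summable hs.le (hR h1.le)
  · exact summable_of_lt_convRadius hs.le (hsR.trans_le h.1)
  · obtain ⟨h1, -, -, η, φ, θs, δ, Gθ, Gκ, -, -, -, -, -, h2, -⟩ := h
    exact h2.summable hs.le (hR h1.le)
  · obtain ⟨h1, η, φ, θs, s', as, δ, Gθ, Gκ, -, -, -, -, -, -, -, -, h2, -⟩ := h
    exact h2.summable hs.le (hR h1.le)

theorem IsRStar.gMod_le_one {κ : ℕ → ℝ} {r : ℝ} (hr : IsRStar κ r) :
    gMod κ 1 (ENNReal.ofReal r) ≤ 1 := by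
  rcases le_total 1 (gModR κ 1) with h | h
  · exact (hr.of_one_le h).le
  · rw [hr.of_le_one h]
    exact h

theorem IsRStar.isSaddle {θ κ : ℕ → ℝ} (hκ : ∀ j : ℕ, 1 ≤ j → 0 ≤ κ j)
    (hpos : ∃ j : ℕ, 2 ≤ j ∧ 0 < κ j) (hyp : AnalyticHyp θ κ) {r : ℝ} (hr : IsRStar κ r) :
    IsSaddle θ κ r where
  pos := hr.pos
  summable_theta _ hs hsr := hyp.summable_theta hr hs hsr
  sum_le_one := (gMod_one_le_one_iff hκ hr.pos.le).1 hr.gMod_le_one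
  one_le_sum ρ hρ := by
    -- If all partial sums at ρ stayed below 1, the terms κ_j ρ^j would be bounded and ρ ≤ R. Then r
    -- < R, so r solves the saddle equation, and strict monotonicity forces a value above 1 at ρ.
    by_contra! hcon
    have hρ0 : 0 < ρ := hr.pos.trans hρ
    have hle : gMod κ 1 (ENNReal.ofReal ρ) ≤ 1 :=
      (gMod_one_le_one_iff hκ hρ0.le).2 fun M => (hcon M).le
    have hρR : ENNReal.ofReal ρ ≤ convRadius κ := by
      refine ofReal_le_convRadius hκ hρ0.le zero_le_one fun j hj => ?_
      refine le_trans ?_ (hcon j).le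
      exact Finset.single_le_sum (f := fun i => κ i * ρ ^ i)
        (fun i hi => mul_nonneg (hκ i (Finset.mem_Icc.1 hi).1) (pow_pos hρ0 i).le)
        (Finset.mem_Icc.2 ⟨hj, le_rfl⟩)
    have hlt : ENNReal.ofReal r < convRadius κ :=
      ((ENNReal.ofReal_lt_ofReal_iff hρ0).2 hρ).trans_le hρR
    have hgt : 1 < gModR κ 1 := not_le.1 fun h => hlt.ne (hr.of_le_one h)
    have h1 := hr.of_one_le hgt.le
    have h2 := gMod_one_strictMono hpos hr.pos.le hρ (by rw [h1]; exact ENNReal.one_ne_top)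
    rw [h1] at h2
    exact absurd hle (not_le.2 h2)

theorem tendsto_sum_gMod_one {κ : ℕ → ℝ} (hκ : ∀ j : ℕ, 1 ≤ j → 0 ≤ κ j) {r : ℝ} (hr : 0 ≤ r)
    (hfin : gMod κ 1 (ENNReal.ofReal r) ≠ ∞) :
    Tendsto (fun K : ℕ => ∑ j ∈ Finset.Icc 1 K, κ j * r ^ j) atTop
      (𝓝 (gMod κ 1 (ENNReal.ofReal r)).toReal) := by
  rw [gMod_one_ofReal hκ hr] at hfin ⊢
  have h1 := (ENNReal.hasSum_toReal hfin).tendsto_sum_nat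
  rw [← ENNReal.tsum_toReal_eq fun j => ENNReal.ofReal_ne_top] at h1
  refine ((tendsto_add_atTop_iff_nat 1).2 h1).congr fun K => ?_
  rw [← sum_range_gMod_one]
  exact Finset.sum_congr rfl fun j _ => ENNReal.toReal_ofReal
    (mul_nonneg (gMod_one_coeff_nonneg hκ j) (pow_nonneg hr j))

end SurrogateSpatial

theorem mainTheorem3 (θ κ : ℕ → ℝ)
    (hθ : ∀ j : ℕ, 1 ≤ j → 0 ≤ θ j) (hκ : ∀ j : ℕ, 1 ≤ j → 0 ≤ κ j)
    (hNA : SurrogateSpatial.NonArithmetic κ)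
    (hR : 0 < SurrogateSpatial.convRadius κ)
    (hyp : SurrogateSpatial.AnalyticHyp θ κ) :
    -- the measures are well defined for all large `N`, and so is `r_*`
    (∀ᶠ N : ℕ in atTop, 0 < SurrogateSpatial.normConst θ κ N) ∧
    (∃! r : ℝ, SurrogateSpatial.IsRStar κ r) ∧
    -- the limit over `N` exists and is explicit
    (∀ r : ℝ, SurrogateSpatial.IsRStar κ r → ∀ K : ℕ,
      Tendsto (fun N : ℕ => SurrogateSpatial.longFraction θ κ K N) atTop
        (𝓝 (SurrogateSpatial.nuK θ κ K)) ∧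
      SurrogateSpatial.nuK θ κ K = 1 - ∑ j ∈ Finset.Icc 1 K, κ j * r ^ j) ∧
    -- the limit over `K`
    Tendsto (fun K : ℕ => SurrogateSpatial.nuK θ κ K) atTop (𝓝 (SurrogateSpatial.nu θ κ)) ∧
    (1 ≤ SurrogateSpatial.gModR κ 1 → SurrogateSpatial.nu θ κ = 0) ∧
    (SurrogateSpatial.gModR κ 1 < 1 →
      SurrogateSpatial.nu θ κ = 1 - (SurrogateSpatial.gModR κ 1).toReal ∧
      0 < SurrogateSpatial.nu θ κ) ∧
    (0 < SurrogateSpatial.nu θ κ ↔ SurrogateSpatial.gModR κ 1 < 1) := by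
  have hpos := hNA.nondegenerate
  obtain ⟨n₀, hn₀⟩ := SurrogateSpatial.exists_forall_ge_mem_closure hNA.aperiodic
    (hpos.imp fun j hj => ⟨by omega, hj.2.ne'⟩)
  have hex := SurrogateSpatial.existsUnique_isRStar hκ hpos hR
  have hlim : ∀ r : ℝ, SurrogateSpatial.IsRStar κ r → ∀ K : ℕ,
      Tendsto (fun N : ℕ => SurrogateSpatial.longFraction θ κ K N) atTop
        (𝓝 (1 - ∑ j ∈ Finset.Icc 1 K, κ j * r ^ j)) := fun r hr K =>
    (hr.isSaddle hκ hpos hyp).tendsto_longFraction hθ hκ hn₀ K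
  have hnuK : ∀ r : ℝ, SurrogateSpatial.IsRStar κ r → ∀ K : ℕ,
      SurrogateSpatial.nuK θ κ K = 1 - ∑ j ∈ Finset.Icc 1 K, κ j * r ^ j := fun r hr K =>
    (hlim r hr K).liminf_eq
  obtain ⟨r, hr, -⟩ := id hex
  have hfin : SurrogateSpatial.gMod κ 1 (ENNReal.ofReal r) ≠ ∞ :=
    (hr.gMod_le_one.trans_lt ENNReal.one_lt_top).ne
  have hK : Tendsto (fun K : ℕ => SurrogateSpatial.nuK θ κ K) atTop
      (𝓝 (1 - (SurrogateSpatial.gMod κ 1 (ENNReal.ofReal r)).toReal)) := by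
    simp_rw [hnuK r hr]
    exact tendsto_const_nhds.sub (SurrogateSpatial.tendsto_sum_gMod_one hκ hr.pos.le hfin)
  have hnu : SurrogateSpatial.nu θ κ =
      1 - (SurrogateSpatial.gMod κ 1 (ENNReal.ofReal r)).toReal := hK.limUnder_eq
  have hge : 1 ≤ SurrogateSpatial.gModR κ 1 → SurrogateSpatial.nu θ κ = 0 := fun h => by
    rw [hnu, hr.of_one_le h, ENNReal.toReal_one, sub_self]
  have hlt : SurrogateSpatial.gModR κ 1 < 1 →
      SurrogateSpatial.nu θ κ = 1 - (SurrogateSpatial.gModR κ 1).toReal ∧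
      0 < SurrogateSpatial.nu θ κ := fun h => by
    have h1 : SurrogateSpatial.nu θ κ = 1 - (SurrogateSpatial.gModR κ 1).toReal := by
      rw [hnu, hr.of_le_one h.le]
      rfl
    have h2 := ENNReal.toReal_lt_of_lt_ofReal (b := 1) (by rwa [ENNReal.ofReal_one])
    exact ⟨h1, by rw [h1]; linarith⟩
  refine ⟨(hr.isSaddle hκ hpos hyp).eventually_normConst_pos hθ hκ hn₀, hex, fun r hr K => ?_,
    by rwa [hnu], hge, hlt, fun h => ?_, fun h => (hlt h).2⟩
  · exact ⟨by rw [hnuK r hr K]; exact hlim r hr K, hnuK r hr K⟩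
  · by_contra hcon
    rw [hge (not_lt.1 hcon)] at h
    exact lt_irrefl _ h
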